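/- **Setting.** A downlink network has finite sets of macro base stations (BSs) $\mathcal M=\{1,\dots,N_0\}$, pico BSs, and users. A bipartite topology graph with edge set $\mathcal E$ joins users and BSs; each user $k$ is served by one BS $b_k$, with $(k,b_k)\in\mathcal E$. Let $\mathcal U_B$ (assumed non-empty) be the set of users that are served by a macro BS and have at least two edges. BS $n$ has transmit power $P_n$, where $P_n=\alpha_nP$ with fixed $\alpha_n>0$ for the macro BSs; the topology graph and the association $b_k$ do not depend on $P$. The channel coefficients are $h_{k,n}=\sigma_{k,n}W_{k,n}$ with fixed $\sigma_{k,n}>0$ and i.i.d. complex $W_{k,n}$ whose law has no atoms and satisfies $\mathrm E\log(1+|W|^2)<\infty$. *Utility.* The weights are $w_k\ge 0$. The function $u$ is concave and strictly increasing on its domain $D$, where $D=[0,\infty)$, or $D=(0,\infty)$ with $u(r)\to-\infty$ as $r\to0^+$; and $u(cr)=f(c)u(r)+g(c)$ for all $c>0$, $r\in D$, with some functions $f>0$ and $g$. A rate outside $D$ has utility $-\infty$, and a user of weight zero always contributes $0$. *Control problem.* A pattern is a vector $a\in\mathcal A=\{0,1\}^{\mathcal M}$ (macro BS $n$ transmits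 iff $a_n=1$); a profile is a subset of $\mathcal A$. A scheduling policy $\pi$ maps (measurably) a pattern $a$ and a channel state $h$ to $\rho\in\{0,1\}^{\text{users}}$ such that each BS schedules at most one user, only users in $\mathcal U_B$ are scheduled, and users of a macro BS $n$ with $a_n=0$ are not scheduled. User $k$ then has mean mutual information $$I_k(\pi,a)=\mathrm E\Big[\rho_k\log\Big(1+\frac{|h_{k,b_k}|^2P_{b_k}}{1+\sum_{n\in\mathcal M,\,n\ne b_k,\,(k,n)\in\mathcal E}a_n|h_{k,n}|^2P_n}\Big)\Big].$$ For a profile $\mathcal A'$ let $U_B^I(\mathcal A')$ be the supremum of $\sum_{k\in\mathcal U_B}w_ku\big(\sum_aQ(a)I_k(\pi,a)\big)$ over all policies $\pi$ and all probability mass functions $Q$ on $\mathcal A$ that vanish outside $\mathcal A'$, and let $U_B^*=U_B^I(\mathcal A)$. *Algorithm B2.* The interference graph has vertex set $\mathcal U_B$; distinct $k,k'$ are adjacent iff $(k,b_{k'})\in\mathcal E$ or $(k',b_k)\in\mathcal E$. For a maximal independent set (MIS) $V$ put $\mathcal I_k(V)=\log(1+P_{b_k}\sigma_{k,b_k}^2)$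 if $k\in V$ and $\mathcal I_k(V)=0$ otherwise. Start with a family $\Theta^{(0)}$ of MISs that covers $\mathcal U_B$. In iteration $i\ge 0$: 1. let $q$ be an optimal solution of $\check U_B(\Theta^{(i)})=\max_q\sum_{k\in\mathcal U_B} w_ku\big(\sum_{V\in\Theta^{(i)}}q_V\mathcal I_k(V)\big)$ over the probability vectors $q$ on $\Theta^{(i)}$; 2. let $\Theta^{(i+1)}=\{V\in\Theta^{(i)}:q_V>0\}\cup\{V^{(i+1)}\}$, where $V^{(i+1)}$ maximizes $\sum_{k\in\mathcal U_B}\mu_k\mathcal I_k(V)$ over all MISs $V$, with $\mu_k=w_ku'\big(\sum_{V'\in\Theta^{(i)}}q_{V'}\mathcal I_k(V')\big)$. Given a tolerance $\varepsilon\ge0$, stop in the first iteration $i\ge1$ with $|\check U_B(\Theta^{(i)})-\check U_B(\Theta^{(i-1)})|\le\varepsilon$, and return the profile $\mathcal A^{B*}=\{a(V):V\in\Theta^{(i)},\,q_V>0\}$, where $a(V)_n=1$ iff macro BS $n$ serves some user in $V$. Call an optimal $q$ in Step 1 *reduced* if no optimal solution has a strictly smaller support (this is automatic if the optimal solution is unique).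 **Theorem.** (a) An initial family exists. For every $P>0$, in every state that the algorithm can reach, Step 1 has an optimal solution, even a reduced one, and Step 2 can be carried out for every optimal solution. (b) For every $P>0$ and $\varepsilon\ge0$ every run of Algorithm B2 terminates; if the last solution of Step 1 is reduced, then $|\mathcal A^{B*}|\le|\mathcal U_B|$. (c) For every $P>0$, the suprema $U_B^*$ and $U_B^I(\mathcal A^{B*})$ are finite, for every profile $\mathcal A^{B*}$ that the algorithm can return with any $\varepsilon\ge 0$; and if $w_k>0$ for some $k\in\mathcal U_B$, then $U_B^*\ne0$ for all large $P$. (d) The returned profile is asymptotically optimal at high SNR: there is a function $\varepsilon_0(P)>0$ such that, whenever for each $P>0$ the profile $\mathcal A^{B*}=\mathcal A^{B*}(P)$ is returned by a run with tolerance $0\le\varepsilon(P)<\varepsilon_0(P)$ (in particular with $\varepsilon=0$), $$\lim_{P\to\infty}\frac{U_B^*-U_B^I(\mathcal A^{B*})}{U_B^*}=0$$ (the quotient being read as $0$ when $U_B^*=0$). -/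

import Mathlib

open MeasureTheory Filter Topology

/-- A two-tier network: `M` is the set of macro base stations, `Q` the set of pico base stations,
`U` the set of users.  `edge k n` says that the topology graph has a link between user `k` and base
station `n`; `serve k` is the base station with which user `k` is associated; `sigma k n` is the
large scale fading coefficient of the pair. -/
structure HetNet (M Q U : Type*) where
  edge : U → M ⊕ Q → Prop
  serve : U → M ⊕ Q
  edge_serve : ∀ k, edge k (serve k)
  sigma : U → M ⊕ Q → ℝ
  sigma_pos : ∀ k n, 0 < sigma k n

/-- A blank-resource-block (ABRB) pattern: `a n = true` if macro base station `n` transmits data,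
`a n = false` if it sends a blank resource block. -/
abbrev Pattern (M : Type*) := M → Bool

/-- The channel state on one subband: one complex coefficient for each (user, base station). -/
abbrev CSI (M Q U : Type*) := U × (M ⊕ Q) → ℂ

/-- Assumptions on the one-user utility `u` with domain `D`, the domain being `[0, ∞)` or `(0, ∞)`:
the rate zero is excluded only if it has utility `-∞`. -/
structure IsUtility (D : Set ℝ) (u : ℝ → ℝ) : Prop where
  pos_mem : Set.Ioi 0 ⊆ D
  nonneg : D ⊆ Set.Ici 0
  zero_notMem : (0 : ℝ) ∉ D → Tendsto u (𝓝[>] 0) atBot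
  concave : ConcaveOn ℝ D u
  increasing : StrictMonoOn u D
  homogeneous : ∃ f g : ℝ → ℝ, ∀ c > 0, 0 < f c ∧ ∀ r ∈ D, u (c * r) = f c * u r + g c

namespace HetNet

noncomputable section

variable {M Q U : Type*}

/-- Type A users: pico cell users, and users with a single edge.  -/
def IsTypeA (N : HetNet M Q U) (k : U) : Prop :=
  (∃ n : Q, N.serve k = Sum.inr n) ∨ {n | N.edge k n}.ncard = 1

/-- Type B users: all other users, that is, macro cell users with an interfering link. -/
def IsTypeB (N : HetNet M Q U) (k : U) : Prop := ¬ N.IsTypeA k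

/-- The set of type B users; it is also the vertex set of the interference graph. -/
abbrev BUser (N : HetNet M Q U) := {k : U // N.IsTypeB k}

/-! ### The control problem on a type B subband -/

/-- A scheduling vector (`ρ k = true` if user `k` is scheduled) is feasible for the pattern `a` on a
type B subband: each base station schedules at most one user, only type B users are scheduled, and
no user of a macro base station that sends a blank resource block is scheduled. -/
def FeasibleSchedule (N : HetNet M Q U) (a : Pattern M) (ρ : U → Bool) : Prop :=
  (∀ k k', ρ k = true → ρ k' = true → N.serve k = N.serve k' → k = k') ∧
  (∀ k, ρ k = true → N.IsTypeB k) ∧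
  (∀ k n, ρ k = true → N.serve k = Sum.inl n → a n = true)

/-- A user scheduling policy for the type B subbands: a (measurable) choice of a feasible scheduling
vector for each pattern and each channel state. -/
structure SchedPolicy (N : HetNet M Q U) where
  toFun : Pattern M → CSI M Q U → U → Bool
  measurable_toFun : ∀ a, Measurable (toFun a)
  feasible : ∀ a h, N.FeasibleSchedule a (toFun a h)

variable [Fintype M] [Fintype Q] [Fintype U]

open scoped Classical in
/-- Interference-plus-noise power at user `k` on a type B subband, for transmit powers `p`: the
interferers are the transmitting macro base stations that are linked to, but do not serve, `k`. -/
def noise (N : HetNet M Q U) (p : M ⊕ Q → ℝ) (a : Pattern M) (h : CSI M Q U) (k : U) : ℝ :=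
  1 + ∑ n : M, if N.edge k (Sum.inl n) ∧ N.serve k ≠ Sum.inl n ∧ a n = true
    then ‖h (k, Sum.inl n)‖ ^ 2 * p (Sum.inl n) else 0

/-- Mutual information of user `k` for the scheduling vector `ρ`. -/
def mutualInfo (N : HetNet M Q U) (p : M ⊕ Q → ℝ) (a : Pattern M) (h : CSI M Q U)
    (ρ : U → Bool) (k : U) : ℝ :=
  if ρ k = true then
    Real.log (1 + ‖h (k, N.serve k)‖ ^ 2 * p (N.serve k) / N.noise p a h k) else 0

/-- The channel state with small scale fading `W`. -/
def csi (N : HetNet M Q U) (W : CSI M Q U) : CSI M Q U := fun x => (N.sigma x.1 x.2 : ℂ) * W x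

/-- Mean mutual information of user `k` under the pattern `a`; the small scale fading coefficients
are i.i.d. with law `ν`. -/
def meanInfo (N : HetNet M Q U) (ν : Measure ℂ) (p : M ⊕ Q → ℝ) (π : N.SchedPolicy)
    (a : Pattern M) (k : U) : ℝ :=
  ∫ W, N.mutualInfo p a (N.csi W) (π.toFun a (N.csi W)) k
    ∂(Measure.pi fun _ : U × (M ⊕ Q) => ν)

open scoped Classical in
/-- Average mutual information of user `k` under the ABRB control policy `q` (a probability mass
function on the patterns) and the user scheduling policy `π`. -/
def avgInfo (N : HetNet M Q U) (ν : Measure ℂ) (p : M ⊕ Q → ℝ) (q : Pattern M → ℝ)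
    (π : N.SchedPolicy) (k : U) : ℝ :=
  ∑ a, q a * N.meanInfo ν p π a k

open scoped Classical in
/-- `q` is a probability mass function on the patterns that vanishes outside the profile `𝒜`. -/
def IsControl (𝒜 : Finset (Pattern M)) (q : Pattern M → ℝ) : Prop :=
  (∀ a, 0 ≤ q a) ∧ ∑ a, q a = 1 ∧ ∀ a, a ∉ 𝒜 → q a = 0

open scoped Classical in
/-- The utilities of the type B users that can be attained with patterns from the profile `𝒜`.
A user of weight zero contributes zero whatever its rate is, also where the rate is not in the
domain of `u`. -/
def utilitySet (N : HetNet M Q U) (ν : Measure ℂ) (w : U → ℝ) (D : Set ℝ) (u : ℝ → ℝ)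
    (p : M ⊕ Q → ℝ) (𝒜 : Finset (Pattern M)) : Set ℝ :=
  {x | ∃ (q : Pattern M → ℝ) (π : N.SchedPolicy), IsControl 𝒜 q ∧
    (∀ k : N.BUser, w k ≠ 0 → N.avgInfo ν p q π k ∈ D) ∧
    x = ∑ k : N.BUser, w k * u (N.avgInfo ν p q π k)}

/-- The optimal value for a given ABRB profile. -/
def profileValue (N : HetNet M Q U) (ν : Measure ℂ) (w : U → ℝ) (D : Set ℝ) (u : ℝ → ℝ)
    (p : M ⊕ Q → ℝ) (𝒜 : Finset (Pattern M)) : ℝ :=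
  sSup (N.utilitySet ν w D u p 𝒜)

open scoped Classical in
/-- The set of all patterns. -/
def allPatterns (M : Type*) [Fintype M] : Finset (Pattern M) := Finset.univ

/-- The optimal value over all patterns. -/
def optValue (N : HetNet M Q U) (ν : Measure ℂ) (w : U → ℝ) (D : Set ℝ) (u : ℝ → ℝ)
    (p : M ⊕ Q → ℝ) : ℝ :=
  N.profileValue ν w D u p (allPatterns M)

/-! ### The interference graph and the column generation algorithm -/

/-- The interference graph on the type B users. -/
def interferenceGraph (N : HetNet M Q U) : SimpleGraph N.BUser where
  Adj k k' := k ≠ k' ∧ (N.edge k (N.serve k') ∨ N.edge k' (N.serve k))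
  symm := ⟨fun _ _ h => ⟨h.1.symm, h.2.symm⟩⟩
  loopless := ⟨fun _ h => h.1 rfl⟩

/-- Maximal independent sets of the interference graph. -/
def IsMIS (N : HetNet M Q U) (V : Finset N.BUser) : Prop :=
  Maximal N.interferenceGraph.IsIndepSet (V : Set N.BUser)

open scoped Classical in
/-- The pattern of a set of users: exactly the macro base stations serving one of them transmit. -/
def patternOf (N : HetNet M Q U) (V : Finset N.BUser) : Pattern M :=
  fun n => decide (∃ k ∈ V, N.serve k = Sum.inl n)

open scoped Classical in
/-- The rate `log (1 + P_n σ_{k,n}²)`, with `n` the base station serving `k`, if `k` belongs to `V`,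
and zero otherwise. -/
def detRate (N : HetNet M Q U) (p : M ⊕ Q → ℝ) (V : Finset N.BUser) (k : N.BUser) : ℝ :=
  if k ∈ V then Real.log (1 + p (N.serve k) * N.sigma k (N.serve k) ^ 2) else 0

/-- The rate of user `k` under the time-sharing coefficients `q`. -/
def mixRate (N : HetNet M Q U) (p : M ⊕ Q → ℝ) (Θ : Finset (Finset N.BUser))
    (q : Finset N.BUser → ℝ) (k : N.BUser) : ℝ :=
  ∑ V ∈ Θ, q V * N.detRate p V k

open scoped Classical in
/-- The objective of Step 1. -/
def mixUtility (N : HetNet M Q U) (w : U → ℝ) (u : ℝ → ℝ) (p : M ⊕ Q → ℝ)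
    (Θ : Finset (Finset N.BUser)) (q : Finset N.BUser → ℝ) : ℝ :=
  ∑ k : N.BUser, w k * u (N.mixRate p Θ q k)

/-- The constraints of Step 1; a rate outside the domain of `u` counts as utility `-∞`, except
that users of weight zero are disregarded. -/
def MixFeasible (N : HetNet M Q U) (w : U → ℝ) (D : Set ℝ) (p : M ⊕ Q → ℝ)
    (Θ : Finset (Finset N.BUser)) (q : Finset N.BUser → ℝ) : Prop :=
  (∀ V, 0 ≤ q V) ∧ (∀ V, V ∉ Θ → q V = 0) ∧ ∑ V ∈ Θ, q V = 1 ∧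
  ∀ k : N.BUser, w k ≠ 0 → N.mixRate p Θ q k ∈ D

/-- Step 1: `q` is an optimal solution for the family `Θ`. -/
def MixOptimal (N : HetNet M Q U) (w : U → ℝ) (D : Set ℝ) (u : ℝ → ℝ) (p : M ⊕ Q → ℝ)
    (Θ : Finset (Finset N.BUser)) (q : Finset N.BUser → ℝ) : Prop :=
  N.MixFeasible w D p Θ q ∧
  ∀ q', N.MixFeasible w D p Θ q' → N.mixUtility w u p Θ q' ≤ N.mixUtility w u p Θ q

/-- An optimal solution of Step 1 without superfluous columns: no optimal solution has a strictly
smaller support.  (If the optimal solution is unique, then it has this property.) -/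
def MixReduced (N : HetNet M Q U) (w : U → ℝ) (D : Set ℝ) (u : ℝ → ℝ) (p : M ⊕ Q → ℝ)
    (Θ : Finset (Finset N.BUser)) (q : Finset N.BUser → ℝ) : Prop :=
  N.MixOptimal w D u p Θ q ∧
  ∀ q', N.MixOptimal w D u p Θ q' → Function.support q' ⊆ Function.support q →
    Function.support q' = Function.support q

/-- The optimal value of Step 1. -/
def mixValue (N : HetNet M Q U) (w : U → ℝ) (D : Set ℝ) (u : ℝ → ℝ) (p : M ⊕ Q → ℝ)
    (Θ : Finset (Finset N.BUser)) : ℝ :=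
  sSup {x | ∃ q, N.MixFeasible w D p Θ q ∧ x = N.mixUtility w u p Θ q}

/-- The weight of user `k` in Step 2: `w_k` times the (one-sided, at zero) derivative of `u` at the
current rate. -/
def mwisWeight (N : HetNet M Q U) (w : U → ℝ) (D : Set ℝ) (u : ℝ → ℝ) (p : M ⊕ Q → ℝ)
    (Θ : Finset (Finset N.BUser)) (q : Finset N.BUser → ℝ) (k : N.BUser) : ℝ :=
  w k * derivWithin u D (N.mixRate p Θ q k)

open scoped Classical in
/-- Step 2: `V` is a maximal independent set with the largest weighted sum of rates. -/
def IsNewColumn (N : HetNet M Q U) (w : U → ℝ) (D : Set ℝ) (u : ℝ → ℝ) (p : M ⊕ Q → ℝ)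
    (Θ : Finset (Finset N.BUser)) (q : Finset N.BUser → ℝ) (V : Finset N.BUser) : Prop :=
  N.IsMIS V ∧ ∀ V', N.IsMIS V' →
    ∑ k : N.BUser, N.mwisWeight w D u p Θ q k * N.detRate p V' k ≤
      ∑ k : N.BUser, N.mwisWeight w D u p Θ q k * N.detRate p V k

open scoped Classical in
/-- The members of `Θ` with a positive coefficient. -/
def activeSets (N : HetNet M Q U) (Θ : Finset (Finset N.BUser)) (q : Finset N.BUser → ℝ) :
    Finset (Finset N.BUser) :=
  {V ∈ Θ | 0 < q V}

open scoped Classical in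
/-- The next family: the members with a positive coefficient, and the new one. -/
def nextFamily (N : HetNet M Q U) (Θ : Finset (Finset N.BUser)) (q : Finset N.BUser → ℝ)
    (V : Finset N.BUser) : Finset (Finset N.BUser) :=
  insert V (N.activeSets Θ q)

/-- Admissible initial families: maximal independent sets that cover all type B users. -/
def IsInitial (N : HetNet M Q U) (Θ : Finset (Finset N.BUser)) : Prop :=
  (∀ V ∈ Θ, N.IsMIS V) ∧ ∀ k : N.BUser, ∃ V ∈ Θ, k ∈ V

/-- The families that the algorithm can reach. -/
inductive Reachable (N : HetNet M Q U) (w : U → ℝ) (D : Set ℝ) (u : ℝ → ℝ) (p : M ⊕ Q → ℝ) :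
    Finset (Finset N.BUser) → Prop
  | init (Θ : Finset (Finset N.BUser)) : N.IsInitial Θ → Reachable N w D u p Θ
  | step (Θ : Finset (Finset N.BUser)) (q : Finset N.BUser → ℝ) (V : Finset N.BUser) :
      Reachable N w D u p Θ → N.MixOptimal w D u p Θ q → N.IsNewColumn w D u p Θ q V →
      Reachable N w D u p (N.nextFamily Θ q V)

/-- A run of the algorithm, before the stopping rule is applied: `Θ i` is the family, `q i` the
optimal solution found in Step 1 and `V i` the set found in Step 2 of iteration `i`. -/
structure IsRun (N : HetNet M Q U) (w : U → ℝ) (D : Set ℝ) (u : ℝ → ℝ) (p : M ⊕ Q → ℝ)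
    (Θ : ℕ → Finset (Finset N.BUser)) (q : ℕ → Finset N.BUser → ℝ) (V : ℕ → Finset N.BUser) :
    Prop where
  init : N.IsInitial (Θ 0)
  step1 : ∀ i, N.MixOptimal w D u p (Θ i) (q i)
  step2 : ∀ i, N.IsNewColumn w D u p (Θ i) (q i) (V i)
  next : ∀ i, Θ (i + 1) = N.nextFamily (Θ i) (q i) (V i)

/-- The stopping rule with tolerance `ε` holds in iteration `i`; there is no earlier value to
compare with in iteration `0`. -/
def Stops (N : HetNet M Q U) (w : U → ℝ) (D : Set ℝ) (u : ℝ → ℝ) (p : M ⊕ Q → ℝ) (ε : ℝ)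
    (Θ : ℕ → Finset (Finset N.BUser)) (i : ℕ) : Prop :=
  1 ≤ i ∧ |N.mixValue w D u p (Θ i) - N.mixValue w D u p (Θ (i - 1))| ≤ ε

/-- The algorithm terminates in iteration `i`, the first one in which the stopping rule holds. -/
def StopsAt (N : HetNet M Q U) (w : U → ℝ) (D : Set ℝ) (u : ℝ → ℝ) (p : M ⊕ Q → ℝ) (ε : ℝ)
    (Θ : ℕ → Finset (Finset N.BUser)) (i : ℕ) : Prop :=
  N.Stops w D u p ε Θ i ∧ ∀ j < i, ¬ N.Stops w D u p ε Θ j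

open scoped Classical in
/-- The ABRB profile of a family of maximal independent sets with coefficients `q`: the patterns of
the members with a positive coefficient. -/
def outputProfile (N : HetNet M Q U) (Θ : Finset (Finset N.BUser)) (q : Finset N.BUser → ℝ) :
    Finset (Pattern M) :=
  (N.activeSets Θ q).image N.patternOf

/-- `𝒜` is an ABRB profile that the algorithm with tolerance `ε` can return. -/
def IsOutput (N : HetNet M Q U) (w : U → ℝ) (D : Set ℝ) (u : ℝ → ℝ) (p : M ⊕ Q → ℝ) (ε : ℝ)
    (𝒜 : Finset (Pattern M)) : Prop :=
  ∃ Θ q V i, N.IsRun w D u p Θ q V ∧ N.StopsAt w D u p ε Θ i ∧ 𝒜 = N.outputProfile (Θ i) (q i)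

end

end HetNet

/-! For nonzero channel coefficients, the rate of a scheduled user grows like `log P` if no base
station serving another scheduled user is linked to it, and stays bounded in `P` otherwise. To first
order a schedule is therefore worth an independent set of the interference graph, and the control
problem becomes Step 1 over the family `allMIS` of all maximal independent sets.

Achievability: `exists_policy` realizes any time sharing of MISs, every user then receiving its
fraction of time multiplied by its interference-free mean rate. Policies are deterministic, so the
random choice is extracted from a link that serves nobody. Converse: `exists_avgInfo_le` sends a
policy to the law of an MIS containing its interference-free scheduled users; the error is at most
`gap`, which does not depend on the policy and is o(log P) by dominated convergence
(`tendsto_gap_div_log`).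

The homogeneity of `u` converts these rate errors into utility errors. Relative to rates of order
`log P`, the gap is a factor `1 ± η` with `η → 0`, which changes a sum of utilities `C` into `f (1 ±
η) * C + g (1 ± η) * ∑ w`, where `f → 1` and `g → 0` at `1`. Both optimal values lie between two
such expressions, so their relative difference vanishes (`tendsto_sub_div_of_scaling`) unless `C`
approaches zero too fast. That is excluded by `eventually_mixValue_ne_zero`, using that `u` is an
affine image of a logarithm or a power (`IsUtility.trichotomy`).

The algorithm is column generation for a concave program. The new column maximizes the directional
derivative of the objective over all MISs; if it brings no improvement, concavity makes the current
value globally optimal (`MixOptimal.le_of_isNewColumn`). The values increase and there are finitely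
many families, hence termination; a sufficiently small tolerance can only be met by exact equality
(`exists_tolerance`). The derivative may be infinite at rate zero, for powers with exponent below
`1`, but then an optimal solution gives positive rates to all covered users of nonzero weight
(`MixOptimal.mixRate_pos`). The bound on the profile holds because the columns of a reduced solution
are linearly independent (`MixReduced.linearIndependent`). -/

/-- A continuous solution of `v (c * r) = v c + v r` on the positive reals is a multiple of the
logarithm. -/
theorem eq_mul_log_of_map_mul {v : ℝ → ℝ} (hc : ContinuousOn v (Set.Ioi 0))
    (hv : ∀ c > 0, ∀ r > 0, v (c * r) = v c + v r) :
    ∃ A, ∀ r > 0, v r = A * Real.log r := by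
  -- With `r = exp t` this is Cauchy's additive equation, whose continuous solutions are linear.
  let φ : ℝ →+ ℝ := AddMonoidHom.mk' (fun t => v (Real.exp t)) (fun s t => by
    simp only [Real.exp_add]; exact hv _ (Real.exp_pos _) _ (Real.exp_pos _))
  have hφ : Continuous φ :=
    hc.comp_continuous Real.continuous_exp (fun t => Real.exp_pos t)
  refine ⟨φ 1, fun r hr => ?_⟩
  have h := map_smul (φ.toRealLinearMap hφ) (Real.log r) (1 : ℝ)
  simp only [smul_eq_mul, mul_one, AddMonoidHom.coe_toRealLinearMap] at h
  have h2 : φ (Real.log r) = v r := by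
    change v (Real.exp (Real.log r)) = v r
    rw [Real.exp_log hr]
  rw [← h2, h, mul_comm]

/-! ### Homogeneous concave utilities: classification, maximizers, one-sided derivatives. -/

namespace IsUtility

variable {D : Set ℝ} {u : ℝ → ℝ}

theorem domain_eq (hu : IsUtility D u) : D = Set.Ici 0 ∨ D = Set.Ioi 0 := by
  by_cases h : (0 : ℝ) ∈ D
  · left
    refine hu.nonneg.antisymm fun x hx => ?_
    rcases eq_or_lt_of_le (show (0 : ℝ) ≤ x from hx) with h0 | h0
    · exact h0 ▸ h
    · exact hu.pos_mem h0
  · right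
    refine Set.Subset.antisymm (fun x hx => Set.mem_Ioi.2 (lt_of_le_of_ne (hu.nonneg hx) ?_)) hu.pos_mem
    rintro rfl; exact h hx

theorem continuousOn_Ioi (hu : IsUtility D u) : ContinuousOn u (Set.Ioi 0) :=
  (hu.concave.subset hu.pos_mem (convex_Ioi 0)).continuousOn isOpen_Ioi

/-- On the positive reals a utility is a logarithm or a power, up to an affine change. -/
theorem log_or_rpow (hu : IsUtility D u) :
    (∃ A B : ℝ, 0 < A ∧ ∀ r > 0, u r = A * Real.log r + B) ∨
    ∃ A B p : ℝ, 0 < A * p ∧ ∀ r > 0, u r = A * r ^ p + B := by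
  obtain ⟨f, g, hfg⟩ := hu.homogeneous
  have hD : ∀ {x : ℝ}, 0 < x → x ∈ D := fun h => hu.pos_mem h
  have hcont := hu.continuousOn_Ioi
  set v : ℝ → ℝ := fun r => u r - u 1 with hvdef
  have hvc : ContinuousOn v (Set.Ioi 0) := hcont.sub continuousOn_const
  have hv : ∀ c > 0, ∀ r > 0, v (c * r) = v c + f c * v r := by
    intro c hc r hr
    have h1 := (hfg c hc).2 r (hD hr)
    have h2 := (hfg c hc).2 1 (hD one_pos)
    simp only [mul_one] at h2
    simp only [hvdef]; rw [h1, h2]; ring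
  have hmono : ∀ r s, 0 < r → r < s → v r < v s := fun r s hr hrs =>
    sub_lt_sub_right (hu.increasing (hD hr) (hD (hr.trans hrs)) hrs) _
  have hv1 : v 1 = 0 := sub_self _
  -- Exchanging `c` and `r` in `hv` leaves the left side unchanged. Hence `v` is proportional to `1
  -- - f`, unless `f` is identically `1`.
  have hsymm : ∀ c > 0, ∀ r > 0, v c * (1 - f r) = v r * (1 - f c) := by
    intro c hc r hr
    have h1 := hv c hc r hr
    have h2 := hv r hr c hc
    rw [mul_comm] at h2; linarith
  have hv2 : 0 < v 2 := hv1 ▸ hmono 1 2 one_pos one_lt_two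
  by_cases hf2 : f 2 = 1
  · left
    have hf : ∀ c > 0, f c = 1 := by
      intro c hc
      have := hsymm c hc 2 two_pos
      rw [hf2, sub_self, mul_zero, eq_comm, mul_eq_zero] at this
      rcases this with h | h <;> linarith
    obtain ⟨A, hA⟩ := eq_mul_log_of_map_mul hvc (fun c hc r hr => by
      rw [hv c hc r hr, hf c hc, one_mul])
    refine ⟨A, u 1, ?_, fun r hr => ?_⟩
    · have := hA 2 two_pos
      have hl : 0 < Real.log 2 := Real.log_pos one_lt_two
      rw [this] at hv2
      exact pos_of_mul_pos_left hv2 hl.le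
    · have := hA r hr
      simp only [hvdef] at this; linarith
  · right
    have h1f : 1 - f 2 ≠ 0 := fun h => hf2 (by linarith)
    set κ := v 2 / (1 - f 2) with hκ
    have hκ0 : κ ≠ 0 := div_ne_zero hv2.ne' h1f
    have hvf : ∀ c > 0, v c = κ * (1 - f c) := by
      intro c hc
      have := hsymm c hc 2 two_pos
      rw [hκ]; field_simp; linarith
    have hfv : ∀ c > 0, f c = 1 - v c / κ := by
      intro c hc; rw [hvf c hc]; field_simp; ring
    have hmul : ∀ c > 0, ∀ r > 0, f (c * r) = f c * f r := by
      intro c hc r hr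
      have h := hv c hc r hr
      rw [hvf _ (mul_pos hc hr), hvf c hc, hvf r hr] at h
      have : κ * (f (c * r) - f c * f r) = 0 := by linarith
      rcases mul_eq_zero.1 this with h | h
      · exact absurd h hκ0
      · linarith
    have hfc : ContinuousOn f (Set.Ioi 0) := by
      have h0 : ContinuousOn (fun c => 1 - v c / κ) (Set.Ioi 0) :=
        continuousOn_const.sub (hvc.div_const κ)
      exact h0.congr (fun c hc => hfv c hc)
    obtain ⟨p, hp⟩ := eq_mul_log_of_map_mul (v := fun r => Real.log (f r))
      (hfc.log fun c hc => (hfg c hc).1.ne') (fun c hc r hr => by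
        rw [hmul c hc r hr, Real.log_mul (hfg c hc).1.ne' (hfg r hr).1.ne'])
    have hfp : ∀ r > 0, f r = r ^ p := by
      intro r hr
      rw [Real.rpow_def_of_pos hr, mul_comm, ← hp r hr, Real.exp_log (hfg r hr).1]
    have hup : ∀ r > 0, u r = -κ * r ^ p + (κ + u 1) := by
      intro r hr
      have := hvf r hr
      simp only [hvdef] at this
      rw [hfp r hr] at this; linarith
    refine ⟨-κ, κ + u 1, p, ?_, hup⟩
    have h2 : v 2 = κ * (1 - 2 ^ p) := by rw [hvf 2 two_pos, hfp 2 two_pos]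
    rw [h2] at hv2
    rcases lt_trichotomy p 0 with h | h | h
    · have : (2 : ℝ) ^ p < 1 := Real.rpow_lt_one_of_one_lt_of_neg one_lt_two h
      have := pos_of_mul_pos_left hv2 (by linarith)
      nlinarith
    · simp [h] at hv2
    · have : 1 < (2 : ℝ) ^ p := Real.one_lt_rpow one_lt_two h
      have : κ < 0 := by
        by_contra hk; push Not at hk
        nlinarith
      nlinarith

/-- The utilities: logarithms, and increasing concave powers, up to an affine change. -/
theorem trichotomy (hu : IsUtility D u) :
    (D = Set.Ioi 0 ∧ ∃ A B : ℝ, 0 < A ∧ ∀ r > 0, u r = A * Real.log r + B) ∨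
    (D = Set.Ici 0 ∧ ∃ A B p : ℝ, 0 < A ∧ 0 < p ∧ p ≤ 1 ∧ ∀ r ≥ 0, u r = A * r ^ p + B) ∨
    (D = Set.Ioi 0 ∧ ∃ A B p : ℝ, A < 0 ∧ p < 0 ∧ ∀ r > 0, u r = A * r ^ p + B) := by
  have hD : ∀ {x : ℝ}, 0 < x → x ∈ D := fun h => hu.pos_mem h
  rcases hu.log_or_rpow with ⟨A, B, hA, h⟩ | ⟨A, B, p, hAp, h⟩
  · left
    refine ⟨hu.domain_eq.resolve_left fun hd => ?_, A, B, hA, h⟩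
    have h0 : (0 : ℝ) ∈ D := hd ▸ Set.self_mem_Ici
    -- At this rate the logarithmic formula already takes the value `u 0`, against strict
    -- monotonicity.
    set r := Real.exp ((u 0 - B) / A) with hr
    have hlt := hu.increasing h0 (hD (Real.exp_pos _ : 0 < r)) (Real.exp_pos _)
    rw [h r (Real.exp_pos _), hr, Real.log_exp, mul_div_cancel₀ _ hA.ne'] at hlt
    linarith
  · right
    rcases lt_trichotomy p 0 with hp | hp | hp
    · have hA : A < 0 := by nlinarith
      right
      refine ⟨hu.domain_eq.resolve_left fun hd => ?_, A, B, p, hA, hp, h⟩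
      have h0 : (0 : ℝ) ∈ D := hd ▸ Set.self_mem_Ici
      have hx : 0 < (|u 0 - B| + 1) / (-A) := by
        have : 0 < -A := by linarith
        positivity
      -- Chosen so that `u r = B - |u 0 - B| - 1`, which is below `u 0`.
      set r := ((|u 0 - B| + 1) / (-A)) ^ p⁻¹ with hr
      have hr0 : 0 < r := Real.rpow_pos_of_pos hx _
      have hlt := hu.increasing h0 (hD hr0) hr0
      rw [h r hr0, hr, Real.rpow_inv_rpow hx.le hp.ne] at hlt
      have : A * ((|u 0 - B| + 1) / -A) = -(|u 0 - B| + 1) := by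
        rw [mul_div_assoc', div_neg, mul_div_cancel_left₀ _ hA.ne]
      rw [this] at hlt
      linarith [neg_abs_le (u 0 - B)]
    · simp [hp] at hAp
    · have hA : 0 < A := pos_of_mul_pos_left hAp hp.le
      left
      have h0 : (0 : ℝ) ∈ D := by
        by_contra h0
        have hb := (hu.zero_notMem h0).eventually (eventually_lt_atBot B)
        obtain ⟨r, hr, hr0⟩ := (hb.and self_mem_nhdsWithin).exists
        rw [h r hr0] at hr
        have : 0 < A * r ^ p := mul_pos hA (Real.rpow_pos_of_pos hr0 _)
        linarith
      have hd : D = Set.Ici 0 := hu.domain_eq.resolve_right fun hd => by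
        rw [hd] at h0; exact lt_irrefl _ (Set.mem_Ioi.1 h0)
      obtain ⟨f, g, hfg⟩ := hu.homogeneous
      -- Both `u 0` and `B` are fixed by the affine map `x ↦ f 2 * x + g 2`, whose slope `2 ^ p`
      -- differs from `1`.
      have hf2 : f 2 ≠ 1 ∧ u 0 = B := by
        have e1 := (hfg 2 two_pos).2 1 (hD one_pos)
        have e2 := (hfg 2 two_pos).2 2 (hD two_pos)
        have e0 := (hfg 2 two_pos).2 0 h0
        rw [h 1 one_pos, h _ (by norm_num)] at e1
        rw [h 2 two_pos, h _ (by norm_num), Real.mul_rpow two_pos.le two_pos.le] at e2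
        rw [mul_zero] at e0
        simp only [mul_one, Real.one_rpow] at e1
        have : 1 < (2 : ℝ) ^ p := Real.one_lt_rpow one_lt_two hp
        set y := (2 : ℝ) ^ p
        have hf : f 2 = y := by
          have : (A * (y - 1)) * (f 2 - y) = 0 := by linarith
          rcases mul_eq_zero.1 this with h | h
          · rcases mul_eq_zero.1 h with h | h <;> linarith
          · linarith
        rw [hf] at e0 e1 ⊢
        refine ⟨by linarith, ?_⟩
        have : (y - 1) * (u 0 - B) = 0 := by linarith
        rcases mul_eq_zero.1 this with h | h <;> linarith
      refine ⟨hd, A, B, p, hA, hp, ?_, ?_⟩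
      · by_contra hp1
        push Not at hp1
        -- An exponent above `1` would make the power strictly convex; the points `1` and `3` with
        -- their midpoint contradict concavity.
        have hc := hu.concave.2 (hD (show (0:ℝ) < 1 from one_pos)) (hD (show (0:ℝ) < 3 by norm_num))
          (show (0 : ℝ) ≤ 1 / 2 by norm_num) (show (0 : ℝ) ≤ 1 / 2 by norm_num) (by norm_num)
        have hc' := (strictConvexOn_rpow hp1).2 (show (1 : ℝ) ∈ Set.Ici 0 by simp)
          (show (3 : ℝ) ∈ Set.Ici 0 by simp) (by norm_num)
          (show (0 : ℝ) < 1 / 2 by norm_num) (show (0 : ℝ) < 1 / 2 by norm_num) (by norm_num)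
        simp only [smul_eq_mul] at hc hc'
        rw [h 1 one_pos, h 3 (by norm_num), h _ (by norm_num)] at hc
        nlinarith
      · intro r hr
        rcases eq_or_lt_of_le (show (0 : ℝ) ≤ r from hr) with h' | h'
        · rw [← h', Real.zero_rpow hp.ne', hf2.2]; ring
        · exact h r h'

theorem continuousOn (hu : IsUtility D u) : ContinuousOn u D := by
  rcases hu.trichotomy with ⟨hd, -⟩ | ⟨hd, A, B, p, hA, hp, -, h⟩ | ⟨hd, -⟩
  · exact hd ▸ hu.continuousOn_Ioi
  · rw [hd]
    refine ContinuousOn.congr (f := fun r : ℝ => A * r ^ p + B) ?_ (fun r hr => h r hr)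
    exact ((Real.continuous_rpow_const hp.le).continuousOn.const_smul A).add continuousOn_const
  · exact hd ▸ hu.continuousOn_Ioi

/-- A utility is differentiable at the positive reals. -/
theorem differentiableAt (hu : IsUtility D u) {x : ℝ} (hx : 0 < x) : DifferentiableAt ℝ u x := by
  have hn : Set.Ioi 0 ∈ 𝓝 x := Ioi_mem_nhds hx
  rcases hu.trichotomy with ⟨-, A, B, -, h⟩ | ⟨-, A, B, p, -, -, -, h⟩ | ⟨-, A, B, p, -, -, h⟩
  · have : DifferentiableAt ℝ (fun r => A * Real.log r + B) x :=
      ((Real.differentiableAt_log hx.ne').const_mul A).add_const B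
    exact this.congr_of_eventuallyEq (by filter_upwards [hn] with r hr using h r hr)
  · have : DifferentiableAt ℝ (fun r => A * r ^ p + B) x :=
      ((Real.differentiableAt_rpow_const_of_ne p hx.ne').const_mul A).add_const B
    exact this.congr_of_eventuallyEq
      (by filter_upwards [hn] with r hr using h r (le_of_lt hr))
  · have : DifferentiableAt ℝ (fun r => A * r ^ p + B) x :=
      ((Real.differentiableAt_rpow_const_of_ne p hx.ne').const_mul A).add_const B
    exact this.congr_of_eventuallyEq (by filter_upwards [hn] with r hr using h r hr)

/-- If a utility is not differentiable in its whole domain, then it is a power with an exponent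
less than `1` on the closed half line. -/
theorem differentiableOn_or (hu : IsUtility D u) : DifferentiableOn ℝ u D ∨
    D = Set.Ici 0 ∧ ∃ A B p : ℝ, 0 < A ∧ 0 < p ∧ p < 1 ∧ ∀ r ≥ 0, u r = A * r ^ p + B := by
  rcases hu.trichotomy with ⟨hd, -⟩ | ⟨hd, A, B, p, hA, hp, hp1, h⟩ | ⟨hd, -⟩
  · left; intro x hx; rw [hd] at hx; exact (hu.differentiableAt hx).differentiableWithinAt
  · rcases hp1.lt_or_eq with hp1 | rfl
    · exact Or.inr ⟨hd, A, B, p, hA, hp, hp1, h⟩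
    · left
      rw [hd]
      refine DifferentiableOn.congr (f := fun r : ℝ => A * r + B) (by fun_prop) fun r hr => ?_
      rw [h r hr, Real.rpow_one]
  · left; intro x hx; rw [hd] at hx; exact (hu.differentiableAt hx).differentiableWithinAt

/-- The scaling functions of a utility are continuous at `1`. -/
theorem exists_scaling (hu : IsUtility D u) : ∃ f g : ℝ → ℝ,
    (∀ c > 0, 0 < f c ∧ ∀ r ∈ D, u (c * r) = f c * u r + g c) ∧
    Tendsto f (𝓝 1) (𝓝 1) ∧ Tendsto g (𝓝 1) (𝓝 0) := by
  obtain ⟨f, g, hfg⟩ := hu.homogeneous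
  have hD : ∀ {x : ℝ}, 0 < x → x ∈ D := fun h => hu.pos_mem h
  refine ⟨f, g, hfg, ?_⟩
  have hlt : u 1 < u 2 := hu.increasing (hD one_pos) (hD two_pos) one_lt_two
  have hn : Set.Ioi (0 : ℝ) ∈ 𝓝 (1 : ℝ) := Ioi_mem_nhds one_pos
  have hc : ∀ r > 0, Tendsto (fun c => u (c * r)) (𝓝 1) (𝓝 (u r)) := by
    intro r hr
    have h := ((hu.differentiableAt hr).continuousAt).tendsto
    refine h.comp ?_
    exact (continuous_id.mul continuous_const).tendsto' _ _ (one_mul r)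
  have hf : Tendsto f (𝓝 1) (𝓝 1) := by
    have h : Tendsto (fun c => (u (c * 2) - u (c * 1)) / (u 2 - u 1)) (𝓝 1) (𝓝 1) := by
      have := ((hc 2 two_pos).sub (hc 1 one_pos)).div_const (u 2 - u 1)
      rwa [div_self (by linarith)] at this
    refine h.congr' ?_
    filter_upwards [hn] with c hc
    rw [(hfg c hc).2 2 (hD two_pos), (hfg c hc).2 1 (hD one_pos), div_eq_iff (by linarith)]
    ring
  refine ⟨hf, ?_⟩
  have h : Tendsto (fun c => u (c * 1) - f c * u 1) (𝓝 1) (𝓝 0) := by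
    have := (hc 1 one_pos).sub (hf.mul_const (u 1))
    simpa using this
  refine h.congr' ?_
  filter_upwards [hn] with c hc
  rw [(hfg c hc).2 1 (hD one_pos)]; ring

theorem mem_of_le (hu : IsUtility D u) {x y : ℝ} (hx : x ∈ D) (hxy : x ≤ y) : y ∈ D := by
  rcases hxy.eq_or_lt with rfl | h
  · exact hx
  · exact hu.pos_mem (lt_of_le_of_lt (Set.mem_Ici.1 (hu.nonneg hx)) h)

theorem mono (hu : IsUtility D u) {x y : ℝ} (hx : x ∈ D) (hxy : x ≤ y) : u x ≤ u y :=
  hu.increasing.monotoneOn hx (hu.mem_of_le hx hxy) hxy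

theorem mul_mem (hu : IsUtility D u) {c x : ℝ} (hc : 0 < c) (hx : x ∈ D) : c * x ∈ D := by
  rcases (Set.mem_Ici.1 (hu.nonneg hx)).eq_or_lt with h | h
  · rw [← h] at hx ⊢; simpa using hx
  · exact hu.pos_mem (mul_pos hc h)

/-- A lower bound for the utility of a rate is a lower bound in the domain for the rate. -/
theorem exists_le_of_le (hu : IsUtility D u) {w : ℝ} (hw : 0 < w) (T : ℝ) :
    ∃ c ∈ D, ∀ r ∈ D, T ≤ w * u r → c ≤ r := by
  by_cases h0 : (0 : ℝ) ∈ D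
  · exact ⟨0, h0, fun r hr _ => hu.nonneg hr⟩
  · have hb := (hu.zero_notMem h0).eventually (eventually_lt_atBot (T / w))
    obtain ⟨c, hc, hcb⟩ := mem_nhdsGT_iff_exists_Ioo_subset.1 hb
    refine ⟨c, hu.pos_mem hc, fun r hr hT => ?_⟩
    by_contra hlt
    push Not at hlt
    have hr0 : 0 < r := lt_of_le_of_ne (hu.nonneg hr) (by rintro rfl; exact h0 hr)
    have : u r < T / w := hcb ⟨hr0, hlt⟩
    rw [lt_div_iff₀ hw] at this
    linarith

/-- Existence of a maximizer of a weighted sum of utilities on a compact set. -/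
theorem exists_max (hu : IsUtility D u) {K X : Type*} [Fintype K] [TopologicalSpace X]
    {w : K → ℝ} (hw : ∀ k, 0 ≤ w k) {S : Set X} (hS : IsCompact S) {x : X → K → ℝ}
    (hx : ∀ k, Continuous fun s => x s k) {s₀ : X} (hs₀ : s₀ ∈ S)
    (hD₀ : ∀ k, w k ≠ 0 → x s₀ k ∈ D) :
    ∃ s ∈ S, (∀ k, w k ≠ 0 → x s k ∈ D) ∧ ∀ s' ∈ S, (∀ k, w k ≠ 0 → x s' k ∈ D) →
      ∑ k, w k * u (x s' k) ≤ ∑ k, w k * u (x s k) := by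
  classical
  set G : X → ℝ := fun s => ∑ k, w k * u (x s k) with hG
  have hb : ∃ R : ℝ, ∀ s ∈ S, ∀ k, x s k ≤ R := by
    have h1 : ∀ k, ∃ R : ℝ, ∀ s ∈ S, x s k ≤ R := fun k =>
      (hS.exists_bound_of_continuousOn (hx k).continuousOn).imp
        fun R hR s hs => (le_abs_self _).trans (hR s hs)
    choose R hR using h1
    exact ⟨∑ k, |R k|, fun s hs k => (hR k s hs).trans ((le_abs_self _).trans
      (Finset.single_le_sum (f := fun k => |R k|) (fun _ _ => abs_nonneg _) (Finset.mem_univ k)))⟩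
  obtain ⟨R, hR⟩ := hb
  -- If a point is at least as good as `s₀`, each single term is at least `T`, since the other users
  -- contribute at most their utilities at `R`. This keeps the rates above some `c k` in the domain,
  -- so the search can be restricted to a compact set on which the objective is continuous.
  set T := G s₀ - ∑ k, |w k * u R| with hT
  have hc : ∀ k, ∃ c, w k ≠ 0 → c ∈ D ∧ ∀ r ∈ D, T ≤ w k * u r → c ≤ r := by
    intro k
    by_cases h : w k = 0
    · exact ⟨0, fun h' => absurd h h'⟩
    · obtain ⟨c, hc, hc'⟩ := hu.exists_le_of_le (lt_of_le_of_ne (hw k) (Ne.symm h)) T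
      exact ⟨c, fun _ => ⟨hc, hc'⟩⟩
  choose c hc using hc
  have key : ∀ s ∈ S, (∀ k, w k ≠ 0 → x s k ∈ D) → G s₀ ≤ G s → ∀ k, w k ≠ 0 → c k ≤ x s k := by
    intro s hs hsD hle k hk
    refine (hc k hk).2 _ (hsD k hk) ?_
    have h1 : G s = w k * u (x s k) + ∑ j ∈ Finset.univ.erase k, w j * u (x s j) :=
      (Finset.add_sum_erase _ _ (Finset.mem_univ k)).symm
    have h2 : ∑ j ∈ Finset.univ.erase k, w j * u (x s j) ≤ ∑ j, |w j * u R| := by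
      refine (Finset.sum_le_sum fun j _ => ?_).trans
        (Finset.sum_le_sum_of_subset_of_nonneg (Finset.erase_subset k _)
          (fun _ _ _ => abs_nonneg _))
      by_cases hj : w j = 0
      · simp [hj]
      · exact (mul_le_mul_of_nonneg_left (hu.mono (hsD j hj) (hR s hs j)) (hw j)).trans
          (le_abs_self _)
    linarith
  set S' := S ∩ {s | ∀ k, w k ≠ 0 → c k ≤ x s k} with hS'
  have hS'c : IsCompact S' := by
    refine hS.inter_right ?_
    simp only [Set.ofPred_forall]
    exact isClosed_iInter fun k => isClosed_iInter fun _ => isClosed_le continuous_const (hx k)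
  have hS'D : ∀ s ∈ S', ∀ k, w k ≠ 0 → x s k ∈ D := fun s hs k hk =>
    hu.mem_of_le (hc k hk).1 (hs.2 k hk)
  have hs₀' : s₀ ∈ S' := ⟨hs₀, key s₀ hs₀ hD₀ le_rfl⟩
  have hGc : ContinuousOn G S' := by
    refine continuousOn_finsetSum _ fun k _ => ?_
    by_cases hk : w k = 0
    · simp only [hk, zero_mul]; exact continuousOn_const
    · exact continuousOn_const.mul
        (hu.continuousOn.comp (hx k).continuousOn fun s hs => hS'D s hs k hk)
  obtain ⟨s, hs, hmax⟩ := hS'c.exists_isMaxOn ⟨s₀, hs₀'⟩ hGc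
  refine ⟨s, hs.1, hS'D s hs, fun s' hs' hD' => ?_⟩
  rcases le_total (G s₀) (G s') with h | h
  · exact hmax ⟨hs', key s' hs' hD' h⟩
  · exact h.trans (hmax hs₀')

/-- The one-sided derivative of a weighted sum of utilities along a segment. -/
theorem hasDerivWithinAt_sum (hu : IsUtility D u) {K : Type*} [Fintype K] {w x y : K → ℝ}
    (hx : ∀ k, w k ≠ 0 → x k ∈ D) (hy : ∀ k, 0 ≤ y k)
    (hd : ∀ k, w k ≠ 0 → DifferentiableWithinAt ℝ u D (x k)) :
    HasDerivWithinAt (fun t => ∑ k, w k * u ((1 - t) * x k + t * y k))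
      (∑ k, w k * derivWithin u D (x k) * (y k - x k)) (Set.Ico 0 1) 0 := by
  refine HasDerivWithinAt.fun_sum fun k _ => ?_
  by_cases hk : w k = 0
  · simp only [hk, zero_mul]; exact hasDerivWithinAt_const _ _ _
  · rw [mul_assoc]
    refine HasDerivWithinAt.const_mul _ ?_
    have hl : HasDerivWithinAt (fun t : ℝ => (1 - t) * x k + t * y k) (y k - x k)
        (Set.Ico 0 1) 0 := by
      have h := (((hasDerivAt_id (0 : ℝ)).const_sub 1).mul_const (x k)).add
        ((hasDerivAt_id (0 : ℝ)).mul_const (y k))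
      refine (h.congr_deriv ?_).hasDerivWithinAt
      ring
    -- The parameter `t = 1` is excluded because `y` need not lie in the domain. For `t < 1` a
    -- positive part of `x` remains, and where `x k = 0` the domain contains zero.
    refine HasDerivWithinAt.comp (h₂ := u) (s' := D) (x := (0 : ℝ)) ?_ hl ?_
    · simpa using (hd k hk).hasDerivWithinAt
    · intro t ht
      rcases (Set.mem_Ici.1 (hu.nonneg (hx k hk))).eq_or_lt with h | h
      · refine hu.mem_of_le (hx k hk) ?_
        rw [← h]; nlinarith [mul_nonneg ht.1 (hy k)]
      · refine hu.pos_mem (Set.mem_Ioi.2 ?_)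
        have := mul_pos (sub_pos.2 ht.2) h
        nlinarith [mul_nonneg ht.1 (hy k)]

end IsUtility

/-- All slopes from zero are at least `a`, hence so is their limit. Applied both to the optimality
of a point (`a = 0`) and to the chord inequality of a concave function. -/
theorem le_deriv_of_add_mul_le {φ : ℝ → ℝ} {φ' a : ℝ}
    (hφ : HasDerivWithinAt φ φ' (Set.Ico 0 1) 0)
    (h : ∀ t ∈ Set.Ioo (0 : ℝ) 1, φ 0 + t * a ≤ φ t) : a ≤ φ' := by
  have h1 : HasDerivWithinAt φ φ' (Set.Ioi 0) 0 :=
    hφ.mono_of_mem_nhdsWithin (mem_of_superset (Ioo_mem_nhdsGT one_pos) Set.Ioo_subset_Ico_self)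
  have h2 := (hasDerivWithinAt_iff_tendsto_slope' (by simp)).1 h1
  refine ge_of_tendsto h2 ?_
  filter_upwards [Ioo_mem_nhdsGT (show (0 : ℝ) < 1 from one_pos)] with t ht
  rw [slope_def_field, sub_zero, le_div_iff₀ ht.1]
  linarith [h t ht]

/-- Applied to the values of the finitely many families: below this tolerance the stopping rule
demands equality. -/
theorem exists_pos_of_finite_values {ι : Type*} [Finite ι] (v : ι → ℝ) :
    ∃ e > 0, ∀ i j, |v i - v j| < e → v i = v j := by
  have h : ∀ᶠ e in 𝓝[>] (0 : ℝ), ∀ i j, |v i - v j| < e → v i = v j := by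
    refine eventually_all.2 fun i => eventually_all.2 fun j => ?_
    by_cases hij : v i = v j
    · exact Eventually.of_forall fun _ _ => hij
    · filter_upwards [Ioo_mem_nhdsGT (abs_pos.2 (sub_ne_zero.2 hij))] with e he hlt
      exact absurd hlt (not_lt.2 he.2.le)
  obtain ⟨e, he, he0⟩ := (h.and self_mem_nhdsWithin).exists
  exact ⟨e, he0, he⟩

/-! ### Maximal independent sets, solvability of Step 1, sparsity of reduced solutions. -/

namespace HetNet

noncomputable section

open scoped Classical

set_option linter.unusedSectionVars false

variable {M Q U : Type*} [Fintype U] {N : HetNet M Q U}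

theorem exists_serve_eq_inl (k : N.BUser) : ∃ n, N.serve k = Sum.inl n := by
  rcases h : N.serve k with n | n
  · exact ⟨n, rfl⟩
  · exact absurd (Or.inl ⟨n, h⟩) k.2

/-- A type B user is linked to a base station that does not serve it. -/
theorem exists_edge_ne_serve (k : N.BUser) : ∃ n, N.edge k n ∧ n ≠ N.serve k := by
  by_contra h
  push Not at h
  refine k.2 (Or.inr ?_)
  rw [Set.ncard_eq_one]
  exact ⟨N.serve k, Set.eq_singleton_iff_unique_mem.2 ⟨N.edge_serve k, fun n hn => h n hn⟩⟩

theorem exists_isMIS_superset {S : Finset N.BUser} (hS : N.interferenceGraph.IsIndepSet S) :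
    ∃ V, N.IsMIS V ∧ S ⊆ V := by
  obtain ⟨T, hST, hT⟩ := Finite.exists_le_maximal
    (p := fun T : Set N.BUser => N.interferenceGraph.IsIndepSet T) hS
  refine ⟨T.toFinset, ?_, fun k hk => Set.mem_toFinset.2 (hST hk)⟩
  unfold IsMIS
  rwa [Set.coe_toFinset]

theorem exists_isMIS_mem (k : N.BUser) : ∃ V, N.IsMIS V ∧ k ∈ V := by
  obtain ⟨V, hV, hk⟩ := exists_isMIS_superset (N := N) (S := {k}) (by
    simp [SimpleGraph.isIndepSet_iff])
  exact ⟨V, hV, hk (Finset.mem_singleton_self k)⟩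

theorem IsMIS.nonempty [Nonempty N.BUser] {V : Finset N.BUser} (hV : N.IsMIS V) :
    V.Nonempty := by
  by_contra h
  rw [Finset.not_nonempty_iff_eq_empty] at h
  subst h
  obtain ⟨k⟩ := ‹Nonempty N.BUser›
  have := hV.le_of_ge (y := {k}) (by simp [SimpleGraph.isIndepSet_iff]) (by simp)
  simpa using this (Set.mem_singleton k)

/-- This serves two purposes: members do not interfere with each other, and, as a user is linked to
its own server, a base station serves at most one member. -/
theorem IsMIS.eq_of_edge {V : Finset N.BUser} (hV : N.IsMIS V) {k k' : N.BUser} (hk : k ∈ V)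
    (hk' : k' ∈ V) (h : N.edge k (N.serve k')) : k = k' := by
  by_contra hne
  exact hV.prop hk hk' hne ⟨hne, Or.inl h⟩

variable (N) in
/-- The family of all maximal independent sets. -/
def allMIS : Finset (Finset N.BUser) := {V | N.IsMIS V}

theorem mem_allMIS {V : Finset N.BUser} : V ∈ N.allMIS ↔ N.IsMIS V := by simp [allMIS]

theorem isInitial_allMIS : N.IsInitial N.allMIS :=
  ⟨fun _ hV => mem_allMIS.1 hV, fun k => (exists_isMIS_mem k).imp
    fun _ h => ⟨mem_allMIS.2 h.1, h.2⟩⟩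

variable (N) in
/-- The rate of a user in the maximal independent sets to which it belongs. -/
def peakRate (p : M ⊕ Q → ℝ) (k : N.BUser) : ℝ :=
  Real.log (1 + p (N.serve k) * N.sigma k (N.serve k) ^ 2)

variable {p : M ⊕ Q → ℝ} {w : U → ℝ} {D : Set ℝ} {u : ℝ → ℝ}
  {Θ Θ' : Finset (Finset N.BUser)} {q q' : Finset N.BUser → ℝ} {V : Finset N.BUser}

theorem detRate_of_mem {k : N.BUser} (h : k ∈ V) : N.detRate p V k = N.peakRate p k := by
  simp [detRate, peakRate, h]

theorem serve_power_pos (hp : ∀ n, 0 < p (Sum.inl n)) (k : N.BUser) : 0 < p (N.serve k) := by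
  obtain ⟨n, hn⟩ := exists_serve_eq_inl k
  rw [hn]; exact hp n

theorem peakRate_pos (hp : ∀ n, 0 < p (Sum.inl n)) (k : N.BUser) : 0 < N.peakRate p k :=
  Real.log_pos (lt_add_of_pos_right _
    (mul_pos (serve_power_pos hp k) (pow_pos (N.sigma_pos _ _) 2)))

theorem detRate_nonneg (hp : ∀ n, 0 < p (Sum.inl n)) (V : Finset N.BUser) (k : N.BUser) :
    0 ≤ N.detRate p V k := by
  by_cases h : k ∈ V
  · rw [detRate_of_mem h]; exact (peakRate_pos hp k).le
  · simp [detRate, h]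

theorem mixRate_nonneg (hp : ∀ n, 0 < p (Sum.inl n)) (hq : ∀ V, 0 ≤ q V) (k : N.BUser) :
    0 ≤ N.mixRate p Θ q k :=
  Finset.sum_nonneg fun V _ => mul_nonneg (hq V) (detRate_nonneg hp V k)

theorem mixRate_pos (hp : ∀ n, 0 < p (Sum.inl n)) (hq : ∀ V, 0 ≤ q V) {k : N.BUser}
    (hV : V ∈ Θ) (hqV : 0 < q V) (hk : k ∈ V) : 0 < N.mixRate p Θ q k := by
  refine Finset.sum_pos' (fun V _ => mul_nonneg (hq V) (detRate_nonneg hp V k)) ⟨V, hV, ?_⟩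
  rw [detRate_of_mem hk]
  exact mul_pos hqV (peakRate_pos hp k)

theorem exists_mem_of_mixRate_ne_zero (hq : ∀ V, 0 ≤ q V) {k : N.BUser}
    (h : N.mixRate p Θ q k ≠ 0) : ∃ V ∈ Θ, 0 < q V ∧ k ∈ V := by
  obtain ⟨V, hV, hne⟩ := Finset.exists_ne_zero_of_sum_ne_zero h
  refine ⟨V, hV, (hq V).lt_of_ne' (left_ne_zero_of_mul hne), ?_⟩
  by_contra hk
  exact hne (by simp [detRate, hk])

theorem mixRate_smul_add (a b : ℝ) (k : N.BUser) :
    N.mixRate p Θ (fun V => a * q V + b * q' V) k =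
      a * N.mixRate p Θ q k + b * N.mixRate p Θ q' k := by
  simp only [mixRate, Finset.mul_sum, ← Finset.sum_add_distrib]
  exact Finset.sum_congr rfl fun V _ => by ring

theorem sum_eq_sum_univ (hq : ∀ V, V ∉ Θ → q V = 0) (F : Finset N.BUser → ℝ) :
    ∑ V ∈ Θ, q V * F V = ∑ V, q V * F V :=
  Finset.sum_subset (Finset.subset_univ _) fun V _ h => by rw [hq V h, zero_mul]

theorem mixRate_eq (hq : ∀ V, V ∉ Θ → q V = 0) (hq' : ∀ V, V ∉ Θ' → q V = 0) :
    N.mixRate p Θ q = N.mixRate p Θ' q := by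
  funext k
  simp only [mixRate]
  rw [sum_eq_sum_univ hq, sum_eq_sum_univ hq']

theorem mixUtility_eq (hq : ∀ V, V ∉ Θ → q V = 0) (hq' : ∀ V, V ∉ Θ' → q V = 0) :
    N.mixUtility w u p Θ q = N.mixUtility w u p Θ' q := by
  simp only [mixUtility, mixRate_eq hq hq']

theorem MixFeasible.of_support (h : N.MixFeasible w D p Θ q) (hq' : ∀ V, V ∉ Θ' → q V = 0) :
    N.MixFeasible w D p Θ' q := by
  refine ⟨h.1, hq', ?_, ?_⟩
  · have := h.2.2.1
    have e1 := sum_eq_sum_univ h.2.1 fun _ => 1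
    have e2 := sum_eq_sum_univ hq' fun _ => 1
    simp only [mul_one] at e1 e2
    rw [e2, ← e1, this]
  · rw [mixRate_eq hq' h.2.1]; exact h.2.2.2

theorem MixOptimal.mixValue_eq (h : N.MixOptimal w D u p Θ q) :
    N.mixValue w D u p Θ = N.mixUtility w u p Θ q :=
  IsGreatest.csSup_eq ⟨⟨q, h.1, rfl⟩, by rintro _ ⟨q', hq', rfl⟩; exact h.2 q' hq'⟩

/-- A convex combination of a feasible point, with positive weight, and a distribution. -/
theorem MixFeasible.mix (hu : IsUtility D u) (hp : ∀ n, 0 < p (Sum.inl n))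
    (h : N.MixFeasible w D p Θ q) (h0 : ∀ V, 0 ≤ q' V) (h1 : ∀ V, V ∉ Θ → q' V = 0)
    (h2 : ∑ V ∈ Θ, q' V = 1) {t : ℝ} (ht : t ∈ Set.Ico (0 : ℝ) 1) :
    N.MixFeasible w D p Θ (fun V => (1 - t) * q V + t * q' V) := by
  have ht' : 0 < 1 - t := sub_pos.2 ht.2
  refine ⟨fun V => add_nonneg (mul_nonneg ht'.le (h.1 V)) (mul_nonneg ht.1 (h0 V)),
    fun V hV => by simp [h.2.1 V hV, h1 V hV], ?_, fun k hk => ?_⟩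
  · rw [Finset.sum_add_distrib, ← Finset.mul_sum, ← Finset.mul_sum, h.2.2.1, h2]; ring
  · rw [mixRate_smul_add]
    exact hu.mem_of_le (hu.mul_mem ht' (h.2.2.2 k hk))
      (le_add_of_nonneg_right (mul_nonneg ht.1 (mixRate_nonneg hp h0 k)))

theorem mixRate_single (hV : V ∈ Θ) (k : N.BUser) :
    N.mixRate p Θ (fun V' => if V' = V then 1 else 0) k = N.detRate p V k := by
  simp [mixRate, hV]

/-- An initial family has a feasible point, with positive rates. -/
theorem IsInitial.exists_feasible [Nonempty N.BUser] (hu : IsUtility D u) (w : U → ℝ)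
    (hΘ : N.IsInitial Θ) : ∃ q, ∀ p : M ⊕ Q → ℝ, (∀ n, 0 < p (Sum.inl n)) →
      N.MixFeasible w D p Θ q ∧ ∀ k, 0 < N.mixRate p Θ q k := by
  have hne : 0 < (Θ.card : ℝ) := by
    obtain ⟨k⟩ := ‹Nonempty N.BUser›
    obtain ⟨V, hV, -⟩ := hΘ.2 k
    exact_mod_cast Finset.card_pos.2 ⟨V, hV⟩
  refine ⟨fun V => if V ∈ Θ then (Θ.card : ℝ)⁻¹ else 0, fun p hp => ?_⟩
  have h0 : ∀ V : Finset N.BUser, 0 ≤ if V ∈ Θ then (Θ.card : ℝ)⁻¹ else 0 := by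
    intro V; split_ifs <;> positivity
  have hpos : ∀ k, 0 < N.mixRate p Θ (fun V => if V ∈ Θ then (Θ.card : ℝ)⁻¹ else 0) k := by
    intro k
    obtain ⟨V, hV, hk⟩ := hΘ.2 k
    exact mixRate_pos hp h0 hV (by simp [hV, hne]) hk
  refine ⟨⟨h0, fun V hV => by simp [hV], ?_, fun k _ => hu.pos_mem (hpos k)⟩, hpos⟩
  rw [Finset.sum_congr rfl fun V hV => if_pos hV, Finset.sum_const, nsmul_eq_mul,
    mul_inv_cancel₀ hne.ne']

/-- Step 1 has an optimal solution if it has a feasible one. -/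
theorem MixFeasible.exists_optimal (hu : IsUtility D u) (hw : ∀ k, 0 ≤ w k)
    (h : N.MixFeasible w D p Θ q) : ∃ q', N.MixOptimal w D u p Θ q' := by
  set S : Set (Finset N.BUser → ℝ) :=
    {q | (∀ V, 0 ≤ q V) ∧ (∀ V, V ∉ Θ → q V = 0) ∧ ∑ V ∈ Θ, q V = 1} with hS
  have hSc : IsCompact S := by
    refine (isCompact_univ_pi fun _ : Finset N.BUser => isCompact_Icc (a := (0 : ℝ))
      (b := 1)).of_isClosed_subset ?_ ?_
    · refine IsClosed.inter ?_ (IsClosed.inter ?_ ?_)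
      · change IsClosed {q : Finset N.BUser → ℝ | ∀ V, 0 ≤ q V}
        simp only [Set.ofPred_forall]
        exact isClosed_iInter fun V => isClosed_le continuous_const (continuous_apply V)
      · change IsClosed {q : Finset N.BUser → ℝ | ∀ V, V ∉ Θ → q V = 0}
        simp only [Set.ofPred_forall]
        exact isClosed_iInter fun V => isClosed_iInter fun _ =>
          isClosed_eq (continuous_apply V) continuous_const
      · exact isClosed_eq (continuous_finsetSum _ fun V _ => continuous_apply V)
          continuous_const
    · rintro q ⟨h0, h1, h2⟩ V -
      refine ⟨h0 V, ?_⟩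
      by_cases hV : V ∈ Θ
      · rw [← h2]; exact Finset.single_le_sum (fun V _ => h0 V) hV
      · rw [h1 V hV]; exact zero_le_one
  obtain ⟨q', hq', hD, hmax⟩ := hu.exists_max (K := N.BUser) (w := fun k => w k)
    (fun k => hw k) hSc (x := fun q k => N.mixRate p Θ q k)
    (fun k => continuous_finsetSum _ fun V _ => (continuous_apply V).mul continuous_const)
    (s₀ := q) ⟨h.1, h.2.1, h.2.2.1⟩ h.2.2.2
  exact ⟨q', ⟨hq'.1, hq'.2.1, hq'.2.2, hD⟩, fun q'' h'' =>
    hmax q'' ⟨h''.1, h''.2.1, h''.2.2.1⟩ h''.2.2.2⟩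

theorem MixOptimal.exists_reduced (h : N.MixOptimal w D u p Θ q) :
    ∃ q', N.MixReduced w D u p Θ q' := by
  obtain ⟨q', hq'⟩ := exists_minimalFor_of_wellFoundedLT (N.MixOptimal w D u p Θ)
    (fun q => Function.support q) ⟨q, h⟩
  exact ⟨q', hq'.1, fun q'' h'' hs => hs.antisymm (hq'.2 h'' hs)⟩

theorem exists_isNewColumn [Nonempty N.BUser] (w : U → ℝ) (D : Set ℝ) (u : ℝ → ℝ)
    (p : M ⊕ Q → ℝ) (Θ : Finset (Finset N.BUser)) (q : Finset N.BUser → ℝ) :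
    ∃ V, N.IsNewColumn w D u p Θ q V := by
  obtain ⟨k⟩ := ‹Nonempty N.BUser›
  obtain ⟨V₀, hV₀, -⟩ := exists_isMIS_mem k
  obtain ⟨V, hV, hmax⟩ := N.allMIS.exists_max_image
    (fun V => ∑ k : N.BUser, N.mwisWeight w D u p Θ q k * N.detRate p V k)
    ⟨V₀, mem_allMIS.2 hV₀⟩
  exact ⟨V, mem_allMIS.1 hV, fun V' hV' => hmax V' (mem_allMIS.2 hV')⟩

theorem eq_zero_of_notMem_nextFamily (h : N.MixFeasible w D p Θ q) {V' : Finset N.BUser}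
    (hV' : V' ∉ N.nextFamily Θ q V) : q V' = 0 := by
  by_contra hne
  refine hV' (Finset.mem_insert_of_mem (Finset.mem_filter.2 ⟨?_, (h.1 V').lt_of_ne' hne⟩))
  by_contra h'
  exact hne (h.2.1 _ h')

/-- Only columns with coefficient zero are dropped, so the solution of one iteration stays feasible
in the next. Covering of all users need not persist and is not required here. -/
theorem Reachable.exists_feasible [Nonempty N.BUser] (hu : IsUtility D u)
    (hp : ∀ n, 0 < p (Sum.inl n)) (h : N.Reachable w D u p Θ) :
    ∃ q, N.MixFeasible w D p Θ q := by
  cases h with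
  | init _ h => exact (h.exists_feasible hu w).imp fun q hq => (hq p hp).1
  | step Θ q V _ hq _ => exact ⟨q, hq.1.of_support fun _ => eq_zero_of_notMem_nextFamily hq.1⟩

/-- The columns of a reduced optimal solution are linearly independent. -/
theorem MixReduced.linearIndependent [Nonempty N.BUser] (hu : IsUtility D u)
    (hw : ∀ k, 0 ≤ w k) (hp : ∀ n, 0 < p (Sum.inl n)) (hΘ : ∀ V ∈ Θ, N.IsMIS V)
    (h : N.MixReduced w D u p Θ q) :
    LinearIndependent ℝ fun V : N.activeSets Θ q => N.detRate p V.1 := by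
  by_contra hli
  obtain ⟨g, hg0, V₀, hgV₀⟩ := Fintype.not_linearIndependent_iff.1 hli
  have hfe := h.1.1
  have hact : ∀ V, V ∈ N.activeSets Θ q ↔ V ∈ Θ ∧ 0 < q V := fun V => Finset.mem_filter
  -- a relation with nonnegative sum
  obtain ⟨c, hc0, hcs, hcr, hcn⟩ : ∃ c : Finset N.BUser → ℝ, (∀ V, V ∉ N.activeSets Θ q → c V = 0) ∧
      0 ≤ ∑ V ∈ Θ, c V ∧ (∀ k, N.mixRate p Θ c k = 0) ∧ ∃ V, c V ≠ 0 := by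
    set c : Finset N.BUser → ℝ := fun V => if hV : V ∈ N.activeSets Θ q then g ⟨V, hV⟩ else 0
      with hc
    have hc0 : ∀ V, V ∉ N.activeSets Θ q → c V = 0 := fun V hV => by simp [hc, hV]
    have hcr : ∀ k, N.mixRate p Θ c k = 0 := by
      intro k
      have h1 := congr_fun hg0 k
      rw [Finset.sum_apply] at h1
      rw [mixRate_eq (Θ' := N.activeSets Θ q)
        (fun V hV => hc0 V fun h' => hV ((hact V).1 h').1) hc0]
      rw [mixRate, ← Finset.sum_coe_sort]
      refine Eq.trans (Finset.sum_congr rfl fun V _ => ?_) h1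
      simp [hc, V.2]
    have hcn : c V₀ ≠ 0 := by simpa [hc, V₀.2] using hgV₀
    rcases le_total 0 (∑ V ∈ Θ, c V) with hs | hs
    · exact ⟨c, hc0, hs, hcr, V₀, hcn⟩
    · refine ⟨fun V => -c V, fun V hV => by simp [hc0 V hV], by simpa using hs, fun k => ?_, V₀,
        by simpa using hcn⟩
      have h2 := hcr k
      simp only [mixRate, neg_mul, Finset.sum_neg_distrib] at h2 ⊢
      rw [h2, neg_zero]
  have hcΘ : ∀ V, V ∉ Θ → c V = 0 := fun V hV => hc0 V fun h' => hV ((hact V).1 h').1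
  -- some coefficient is positive
  have hpos : ∃ V ∈ Θ, 0 < c V := by
    by_contra hno
    push Not at hno
    have hz : ∑ V ∈ Θ, c V = 0 := le_antisymm (Finset.sum_nonpos hno) hcs
    obtain ⟨V, hV⟩ := hcn
    by_cases hVΘ : V ∈ Θ
    · exact hV ((Finset.sum_eq_zero_iff_of_nonpos hno).1 hz V hVΘ)
    · exact hV (hcΘ V hVΘ)
  -- Ratio test: subtracting multiples of `c` from `q` leaves the rates unchanged, and `V₁` is a
  -- column whose coefficient reaches zero first.
  obtain ⟨V₁, hV₁, hmin⟩ := (Θ.filter fun V => 0 < c V).exists_min_image (fun V => q V / c V)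
    (by obtain ⟨V, hV, hcV⟩ := hpos; exact ⟨V, Finset.mem_filter.2 ⟨hV, hcV⟩⟩)
  rw [Finset.mem_filter] at hV₁
  set t := q V₁ / c V₁ with ht
  have hqV₁ : 0 < q V₁ := by
    by_contra hn
    exact hV₁.2.ne' (hc0 _ fun h' => hn ((hact _).1 h').2)
  have ht0 : 0 < t := div_pos hqV₁ hV₁.2
  have hnn : ∀ V, 0 ≤ q V - t * c V := by
    intro V
    rcases le_or_gt (c V) 0 with h' | h'
    · nlinarith [hfe.1 V]
    · have hVΘ : V ∈ Θ := by by_contra hV; exact h'.ne' (hcΘ V hV)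
      have := hmin V (Finset.mem_filter.2 ⟨hVΘ, h'⟩)
      rw [le_div_iff₀ h'] at this
      linarith
  set s := 1 - t * ∑ V ∈ Θ, c V with hs
  have hsum : ∑ V ∈ Θ, (q V - t * c V) = s := by
    rw [Finset.sum_sub_distrib, ← Finset.mul_sum, hfe.2.2.1]
  have hrate : ∀ k, N.mixRate p Θ (fun V => q V - t * c V) k = N.mixRate p Θ q k := by
    intro k
    have := mixRate_smul_add (N := N) (p := p) (Θ := Θ) (q := q) (q' := c) 1 (-t) k
    rw [hcr k] at this
    simpa [sub_eq_add_neg] using this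
  -- If no mass remained, all rates would be zero, but the nonempty set `V₁` gives its members
  -- positive rates under `q`.
  have hs0 : 0 < s := by
    rcases (hsum ▸ Finset.sum_nonneg fun V _ => hnn V : 0 ≤ s).eq_or_lt with h' | h'
    · exfalso
      rw [← h', Finset.sum_eq_zero_iff_of_nonneg fun V _ => hnn V] at hsum
      obtain ⟨k, hk⟩ := (hΘ V₁ hV₁.1).nonempty
      have h1 := mixRate_pos hp hfe.1 hV₁.1 hqV₁ hk
      rw [← hrate k, mixRate, Finset.sum_eq_zero fun V hV => by rw [hsum V hV, zero_mul]] at h1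
      exact lt_irrefl _ h1
    · exact h'
  have hs1 : s ≤ 1 := by
    have := mul_nonneg ht0.le hcs
    linarith
  -- The remaining mass `s` is at most `1`, thanks to the sign chosen for `∑ c`, so normalizing can
  -- only increase the rates. The result is optimal with a smaller support.
  set q' : Finset N.BUser → ℝ := fun V => s⁻¹ * (q V - t * c V) with hq'
  have hrate' : ∀ k, N.mixRate p Θ q' k = s⁻¹ * N.mixRate p Θ q k := by
    intro k
    rw [← hrate k]
    simp only [mixRate, hq', Finset.mul_sum, mul_assoc]
  have hle : ∀ k, N.mixRate p Θ q k ≤ N.mixRate p Θ q' k := fun k => by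
    rw [hrate' k]
    exact le_mul_of_one_le_left (mixRate_nonneg hp hfe.1 k) ((one_le_inv₀ hs0).2 hs1)
  have hfe' : N.MixFeasible w D p Θ q' := by
    refine ⟨fun V => mul_nonneg (inv_nonneg.2 hs0.le) (hnn V), fun V hV => ?_, ?_, fun k hk =>
      hu.mem_of_le (hfe.2.2.2 k hk) (hle k)⟩
    · simp [hq', hfe.2.1 V hV, hcΘ V hV]
    · rw [← Finset.mul_sum, hsum, inv_mul_cancel₀ hs0.ne']
  have hU : N.mixUtility w u p Θ q ≤ N.mixUtility w u p Θ q' := by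
    refine Finset.sum_le_sum fun k _ => ?_
    by_cases hk : w k = 0
    · simp [hk]
    · exact mul_le_mul_of_nonneg_left (hu.mono (hfe.2.2.2 k hk) (hle k)) (hw k)
  have hopt : N.MixOptimal w D u p Θ q' := ⟨hfe', fun q'' h'' => (h.1.2 q'' h'').trans hU⟩
  have hsupp := h.2 q' hopt fun V hV => by
    by_contra hqV
    have hqV : q V = 0 := by simpa using hqV
    have : c V = 0 := hc0 V fun h' => ((hact V).1 h').2.ne' hqV
    exact hV (by simp [hq', hqV, this])
  have : V₁ ∈ Function.support q' := hsupp ▸ hqV₁.ne'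
  refine this ?_
  rw [hq']
  simp only [ht, div_mul_cancel₀ _ hV₁.2.ne', sub_self, mul_zero]

/-- The independent columns live in a space of dimension `|U_B|`, and distinct columns may even
share a pattern. -/
theorem MixReduced.card_outputProfile_le [Fintype M] [Nonempty N.BUser] (hu : IsUtility D u)
    (hw : ∀ k, 0 ≤ w k) (hp : ∀ n, 0 < p (Sum.inl n)) (hΘ : ∀ V ∈ Θ, N.IsMIS V)
    (h : N.MixReduced w D u p Θ q) : (N.outputProfile Θ q).card ≤ Nat.card N.BUser := by
  have h1 := (h.linearIndependent hu hw hp hΘ).fintype_card_le_finrank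
  rw [Module.finrank_fintype_fun_eq_card, ← Nat.card_eq_fintype_card (α := N.BUser)] at h1
  refine Finset.card_image_le.trans ?_
  simpa using h1

end

end HetNet

/-! ### Column generation: invariants, termination, global optimality. -/

namespace HetNet

noncomputable section

open scoped Classical

set_option linter.unusedSectionVars false

variable {M Q U : Type*} [Fintype U] {N : HetNet M Q U}
  {p : M ⊕ Q → ℝ} {w : U → ℝ} {D : Set ℝ} {u : ℝ → ℝ}
  {Θ Θ' : Finset (Finset N.BUser)} {q q' : Finset N.BUser → ℝ} {V : Finset N.BUser}

/-- For a power with an exponent less than `1`, all users that can be served have positive rates at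
an optimal solution. -/
theorem MixOptimal.mixRate_pos (hu : IsUtility D u) (hw : ∀ k, 0 ≤ w k)
    (hp : ∀ n, 0 < p (Sum.inl n)) (h : N.MixOptimal w D u p Θ q) {A B r : ℝ} (hA : 0 < A)
    (hr0 : 0 < r) (hr1 : r < 1) (hur : ∀ x ≥ 0, u x = A * x ^ r + B) {k : N.BUser}
    (hk : w k ≠ 0) (hV : V ∈ Θ) (hkV : k ∈ V) : 0 < N.mixRate p Θ q k := by
  refine lt_of_le_of_ne (mixRate_nonneg hp h.1.1 k) fun hzero => ?_
  set x := N.mixRate p Θ q with hx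
  have hx0 : ∀ j, 0 ≤ x j := mixRate_nonneg hp h.1.1
  set S := ∑ j : N.BUser, w j * x j ^ r with hS
  set c := w k * N.peakRate p k ^ r with hc
  have hwk : 0 < w k := lt_of_le_of_ne (hw k) (Ne.symm hk)
  have hc0 : 0 < c := mul_pos hwk (Real.rpow_pos_of_pos (peakRate_pos hp k) r)
  have hS0 : 0 ≤ S := Finset.sum_nonneg fun j _ => mul_nonneg (hw j) (Real.rpow_nonneg (hx0 j) r)
  -- Shifting mass `t` to the column `V` gains `t ^ r * c` from user `k`, whose rate was zero, and
  -- costs the others at most `t * S`. For small `t` the gain prevails, since `r < 1`.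
  have key : ∀ t ∈ Set.Ioo (0 : ℝ) 1, t ^ r * c ≤ t * S := by
    intro t ht
    have ht1 : 0 < 1 - t := sub_pos.2 ht.2
    set e : Finset N.BUser → ℝ := fun V' => if V' = V then 1 else 0 with he
    have he0 : ∀ V', 0 ≤ e V' := fun V' => by simp only [he]; split_ifs <;> norm_num
    have hmix := h.1.mix (q' := e) hu hp he0 (fun V' hV' => by
      simp only [he]; rw [if_neg]; rintro rfl; exact hV' hV) (by simp [he, hV]) ⟨ht.1.le, ht.2⟩
    have hle := h.2 _ hmix
    simp only [mixUtility, mixRate_smul_add] at hle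
    rw [← hx] at hle
    set y := N.mixRate p Θ e with hy
    have hy0 : ∀ j, 0 ≤ y j := mixRate_nonneg hp he0
    have hyk : y k = N.peakRate p k := by rw [hy, mixRate_single hV, detRate_of_mem hkV]
    have hterm : ∀ j : N.BUser, w j * ((1 - t) * x j ^ r) ≤ w j * ((1 - t) * x j + t * y j) ^ r := by
      intro j
      refine mul_le_mul_of_nonneg_left ?_ (hw j)
      calc (1 - t) * x j ^ r ≤ (1 - t) ^ r * x j ^ r := by
            refine mul_le_mul_of_nonneg_right ?_ (Real.rpow_nonneg (hx0 j) r)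
            exact Real.self_le_rpow_of_le_one ht1.le (by linarith [ht.1]) hr1.le
        _ = ((1 - t) * x j) ^ r := (Real.mul_rpow ht1.le (hx0 j)).symm
        _ ≤ _ := Real.rpow_le_rpow (mul_nonneg ht1.le (hx0 j))
            (le_add_of_nonneg_right (mul_nonneg ht.1.le (hy0 j))) hr0.le
    have hk' : w k * ((1 - t) * x k + t * y k) ^ r = t ^ r * c := by
      rw [← hzero, hyk, mul_zero, zero_add, Real.mul_rpow ht.1.le (peakRate_pos hp k).le, hc]
      ring
    have hsum : (1 - t) * S + t ^ r * c ≤ ∑ j : N.BUser, w j * ((1 - t) * x j + t * y j) ^ r := by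
      rw [← Finset.add_sum_erase _ _ (Finset.mem_univ k), hk', hS, Finset.mul_sum,
        ← Finset.add_sum_erase _ _ (Finset.mem_univ k), ← hzero, Real.zero_rpow hr0.ne', mul_zero,
        mul_zero, zero_add, add_comm]
      refine add_le_add_right (Finset.sum_le_sum fun j _ => ?_) _
      rw [mul_left_comm]; exact hterm j
    have e1 : ∀ z : N.BUser → ℝ, (∀ j, 0 ≤ z j) → ∑ j : N.BUser, w j * u (z j) =
        A * ∑ j : N.BUser, w j * z j ^ r + B * ∑ j : N.BUser, w j := by
      intro z hz
      rw [Finset.mul_sum, Finset.mul_sum, ← Finset.sum_add_distrib]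
      exact Finset.sum_congr rfl fun j _ => by rw [hur _ (hz j)]; ring
    rw [e1 _ fun j => add_nonneg (mul_nonneg ht1.le (hx0 j)) (mul_nonneg ht.1.le (hy0 j)),
      e1 _ hx0] at hle
    have := le_of_mul_le_mul_left (le_of_add_le_add_right hle) hA
    linarith
  have hlim : Tendsto (fun t : ℝ => t ^ (1 - r) * S) (𝓝[>] 0) (𝓝 0) := by
    have h1 : Tendsto (fun t : ℝ => t ^ (1 - r) * S) (𝓝 0) (𝓝 (0 ^ (1 - r) * S)) :=
      ((Real.continuous_rpow_const (sub_pos.2 hr1).le).mul continuous_const).tendsto 0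
    rw [Real.zero_rpow (sub_pos.2 hr1).ne', zero_mul] at h1
    exact h1.mono_left nhdsWithin_le_nhds
  refine absurd (ge_of_tendsto hlim (b := c) ?_) (not_le.2 hc0)
  filter_upwards [Ioo_mem_nhdsGT (show (0 : ℝ) < 1 from one_pos)] with t ht
  have h1 := key t ht
  have h2 : t = t ^ r * t ^ (1 - r) := by
    rw [← Real.rpow_add ht.1]; simp
  have h3 : 0 < t ^ r := Real.rpow_pos_of_pos ht.1 r
  rw [h2, ← h2, show t * S = t ^ r * (t ^ (1 - r) * S) by rw [← mul_assoc, ← h2]] at h1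
  exact le_of_mul_le_mul_left h1 h3

/-- If the new column does not improve the optimal value, then the value is optimal over all
families of maximal independent sets. -/
theorem MixOptimal.le_of_isNewColumn (hu : IsUtility D u) (hw : ∀ k, 0 ≤ w k)
    (hp : ∀ n, 0 < p (Sum.inl n)) (h : N.MixOptimal w D u p Θ q)
    (hd : ∀ k : N.BUser, w k ≠ 0 → DifferentiableWithinAt ℝ u D (N.mixRate p Θ q k))
    (hV : N.IsNewColumn w D u p Θ q V)
    (hle : ∀ q', N.MixFeasible w D p (N.nextFamily Θ q V) q' →
      N.mixUtility w u p (N.nextFamily Θ q V) q' ≤ N.mixUtility w u p Θ q)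
    (hΘ' : ∀ V ∈ Θ', N.IsMIS V) (hq' : N.MixFeasible w D p Θ' q') :
    N.mixUtility w u p Θ' q' ≤ N.mixUtility w u p Θ q := by
  set x := N.mixRate p Θ q with hx
  set y := N.mixRate p Θ' q' with hy
  set μ : N.BUser → ℝ := fun k => N.mwisWeight w D u p Θ q k with hμ
  have hxD : ∀ k : N.BUser, w k ≠ 0 → x k ∈ D := h.1.2.2.2
  have hy0 : ∀ k, 0 ≤ y k := mixRate_nonneg hp hq'.1
  have hqn : ∀ V', V' ∉ N.nextFamily Θ q V → q V' = 0 := fun V' => eq_zero_of_notMem_nextFamily h.1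
  have hVn : V ∈ N.nextFamily Θ q V := Finset.mem_insert_self _ _
  -- moving towards the new column
  have h1 : ∑ k : N.BUser, w k * derivWithin u D (x k) * (N.detRate p V k - x k) ≤ 0 := by
    have hder := (hu.hasDerivWithinAt_sum (w := fun k : N.BUser => w k) hxD
      (fun k => detRate_nonneg hp V k) hd).neg
    have := le_deriv_of_add_mul_le hder (a := 0) fun t ht => ?_
    · linarith
    set e : Finset N.BUser → ℝ := fun V' => if V' = V then 1 else 0 with he
    have hfe := (h.1.of_support hqn).mix (q' := e) hu hp
      (fun V' => by simp only [he]; split_ifs <;> norm_num) (fun V' hV' => by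
      simp only [he]; rw [if_neg]; rintro rfl; exact hV' hVn) (by simp [he, hVn]) ⟨ht.1.le, ht.2⟩
    have h2 := hle _ hfe
    simp only [mixUtility, mixRate_smul_add, he, mixRate_single hVn] at h2
    rw [mixRate_eq hqn h.1.2.1, ← hx] at h2
    simpa using h2
  -- moving towards the other point
  have h2 : N.mixUtility w u p Θ' q' - N.mixUtility w u p Θ q ≤
      ∑ k : N.BUser, w k * derivWithin u D (x k) * (y k - x k) := by
    refine le_deriv_of_add_mul_le (hu.hasDerivWithinAt_sum (w := fun k : N.BUser => w k) hxD
      hy0 hd) fun t ht => ?_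
    simp only [mixUtility]
    rw [← hx, ← hy]
    rw [show ∑ k : N.BUser, w k * u ((1 - 0) * x k + 0 * y k) = ∑ k : N.BUser, w k * u (x k) by
      simp]
    rw [← Finset.sum_sub_distrib, Finset.mul_sum, ← Finset.sum_add_distrib]
    refine Finset.sum_le_sum fun k _ => ?_
    by_cases hk : w k = 0
    · simp [hk]
    · have hc := hu.concave.2 (hxD k hk) (hq'.2.2.2 k hk) (sub_pos.2 ht.2).le ht.1.le
        (sub_add_cancel 1 t)
      simp only [smul_eq_mul] at hc
      have := mul_le_mul_of_nonneg_left hc (hw k)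
      rw [← hy] at this
      linarith
  -- the new column has the largest weight
  have h3 : ∑ k : N.BUser, μ k * y k ≤ ∑ k : N.BUser, μ k * N.detRate p V k := by
    have e1 : ∑ k : N.BUser, μ k * y k =
        ∑ V' ∈ Θ', q' V' * ∑ k : N.BUser, μ k * N.detRate p V' k := by
      simp only [hy, mixRate, Finset.mul_sum]
      rw [Finset.sum_comm]
      exact Finset.sum_congr rfl fun V' _ => Finset.sum_congr rfl fun k _ => by ring
    rw [e1, ← one_mul (∑ k : N.BUser, μ k * N.detRate p V k), ← hq'.2.2.1, Finset.sum_mul]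
    exact Finset.sum_le_sum fun V' hV' =>
      mul_le_mul_of_nonneg_left (hV.2 V' (hΘ' V' hV')) (hq'.1 V')
  -- Altogether the gain is at most `∑ μ (y - x) ≤ ∑ μ (detRate V - x) ≤ 0`.
  simp only [mul_sub, Finset.sum_sub_distrib] at h1 h2
  simp only [hμ, mwisWeight, ← hx] at h3
  linarith

section Run

variable {Θ : ℕ → Finset (Finset N.BUser)} {q : ℕ → Finset N.BUser → ℝ}
  {V : ℕ → Finset N.BUser}

theorem IsRun.isMIS (h : N.IsRun w D u p Θ q V) (i : ℕ) : ∀ V' ∈ Θ i, N.IsMIS V' := by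
  induction i with
  | zero => exact h.init.1
  | succ i ih =>
    rw [h.next i]
    intro V' hV'
    rcases Finset.mem_insert.1 hV' with rfl | hV'
    · exact (h.step2 i).1
    · exact ih V' (Finset.mem_filter.1 hV').1

/-- The previous solution remains feasible, with the same utility, after its inactive columns are
removed. -/
theorem IsRun.mixValue_mono (h : N.IsRun w D u p Θ q V) :
    Monotone fun i => N.mixValue w D u p (Θ i) := by
  refine monotone_nat_of_le_succ fun i => ?_
  have hz : ∀ V', V' ∉ Θ (i + 1) → q i V' = 0 := by
    intro V'; rw [h.next i]; exact eq_zero_of_notMem_nextFamily (h.step1 i).1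
  rw [(h.step1 i).mixValue_eq, (h.step1 (i + 1)).mixValue_eq,
    mixUtility_eq (h.step1 i).1.2.1 hz]
  exact (h.step1 (i + 1)).2 _ ((h.step1 i).1.of_support hz)

theorem IsRun.exists_stopsAt (h : N.IsRun w D u p Θ q V) {ε : ℝ} (hε : 0 ≤ ε) :
    ∃ i, N.StopsAt w D u p ε Θ i := by
  have hex : ∃ i, N.Stops w D u p ε Θ i := by
    by_contra hno
    push Not at hno
    have hs : StrictMono fun i => N.mixValue w D u p (Θ i) := by
      refine strictMono_nat_of_lt_succ fun i => lt_of_le_of_ne (h.mixValue_mono i.le_succ) ?_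
      intro heq
      refine hno (i + 1) ⟨Nat.le_add_left _ _, ?_⟩
      simpa [heq] using hε
    -- A strictly increasing value would never allow a family to recur, although there are finitely
    -- many.
    have hinj : Function.Injective Θ := fun i j hij => hs.injective (by simp only [hij])
    exact not_injective_infinite_finite Θ hinj
  exact ⟨Nat.find hex, Nat.find_spec hex, fun j hj => Nat.find_min hex hj⟩

/-- Guarantees that the weights of Step 2 are true derivatives and not the default value of
`derivWithin`. For powers with exponent below `1` the rate must be positive, which requires that the
user is still covered. -/
theorem IsRun.differentiableWithinAt (hu : IsUtility D u) (hw : ∀ k, 0 ≤ w k)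
    (hp : ∀ n, 0 < p (Sum.inl n)) (h : N.IsRun w D u p Θ q V) (i : ℕ) (k : N.BUser)
    (hk : w k ≠ 0) : DifferentiableWithinAt ℝ u D (N.mixRate p (Θ i) (q i) k) := by
  rcases hu.differentiableOn_or with hd | ⟨-, A, B, r, hA, hr0, hr1, hur⟩
  · exact hd _ ((h.step1 i).1.2.2.2 k hk)
  · have hcov : ∀ i, ∃ V' ∈ Θ i, k ∈ V' := by
      intro i
      induction i with
      | zero => exact h.init.2 k
      | succ i ih =>
        obtain ⟨V', hV', hkV'⟩ := ih
        have hpos := (h.step1 i).mixRate_pos hu hw hp hA hr0 hr1 hur hk hV' hkV'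
        obtain ⟨V'', hV'', hqV, hkV''⟩ :=
          exists_mem_of_mixRate_ne_zero (h.step1 i).1.1 hpos.ne'
        rw [h.next i]
        exact ⟨V'', Finset.mem_insert_of_mem (Finset.mem_filter.2 ⟨hV'', hqV⟩), hkV''⟩
    obtain ⟨V', hV', hkV'⟩ := hcov i
    exact (hu.differentiableAt ((h.step1 i).mixRate_pos hu hw hp hA hr0 hr1 hur hk hV'
      hkV')).differentiableWithinAt

/-- A run whose value stays the same in one iteration has found the optimal value over all maximal
independent sets. -/
theorem IsRun.mixOptimal_allMIS (hu : IsUtility D u) (hw : ∀ k, 0 ≤ w k)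
    (hp : ∀ n, 0 < p (Sum.inl n)) (h : N.IsRun w D u p Θ q V) {i : ℕ}
    (hi : N.mixValue w D u p (Θ (i + 1)) = N.mixValue w D u p (Θ i)) :
    N.MixOptimal w D u p N.allMIS (q (i + 1)) := by
  have hz : ∀ V', V' ∉ N.allMIS → q (i + 1) V' = 0 := fun V' hV' =>
    (h.step1 (i + 1)).1.2.1 V' fun h' => hV' (mem_allMIS.2 (h.isMIS _ V' h'))
  have hv := hi
  rw [(h.step1 i).mixValue_eq, (h.step1 (i + 1)).mixValue_eq] at hv
  refine ⟨(h.step1 (i + 1)).1.of_support hz, fun q' hq' => ?_⟩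
  rw [← mixUtility_eq (h.step1 (i + 1)).1.2.1 hz, hv]
  -- Differentiability and the new column belong to iteration `i`; equality of the values transfers
  -- optimality to the solution of iteration `i + 1`.
  refine (h.step1 i).le_of_isNewColumn hu hw hp (h.differentiableWithinAt hu hw hp i) (h.step2 i)
    (fun q'' hq'' => ?_) (fun V' => mem_allMIS.1) hq'
  rw [← h.next i] at hq'' ⊢
  rw [← hv]
  exact (h.step1 (i + 1)).2 q'' hq''

end Run

/-- For small tolerances the coefficients in the last iteration are optimal over all maximal
independent sets. -/
theorem exists_tolerance (hu : IsUtility D u) (hw : ∀ k, 0 ≤ w k)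
    (hp : ∀ n, 0 < p (Sum.inl n)) : ∃ ε₀ > 0, ∀ ε < ε₀, ∀ Θ q V i, N.IsRun w D u p Θ q V →
      N.StopsAt w D u p ε Θ i → N.MixOptimal w D u p N.allMIS (q i) := by
  -- All families are separated at once, so `ε₀` depends on the powers but not on the run.
  obtain ⟨ε₀, h0, hε₀⟩ := exists_pos_of_finite_values (N.mixValue w D u p)
  refine ⟨ε₀, h0, fun ε hε Θ q V i hrun hfinal => ?_⟩
  obtain ⟨⟨hi, hle⟩, -⟩ := hfinal
  obtain ⟨i, rfl⟩ := Nat.exists_eq_add_of_le' hi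
  exact hrun.mixOptimal_allMIS hu hw hp (hε₀ _ _ (hle.trans_lt hε))

end

end HetNet

/-! ### Nonatomic laws as sources of randomness, independence, logarithmic estimates. -/

/-- A finite measure on the real line without atoms attains all intermediate values. -/
theorem exists_measurableSet_measureReal_eq (m : Measure ℝ) [IsFiniteMeasure m]
    [NullSingletonClass m] {c : ℝ} (h0 : 0 ≤ c) (h1 : c ≤ m.real Set.univ) :
    ∃ B, MeasurableSet B ∧ m.real B = c := by
  rcases h1.eq_or_lt with rfl | h1
  · exact ⟨_, MeasurableSet.univ, rfl⟩
  have hint : Integrable (fun _ : ℝ => (1 : ℝ)) m := integrable_const 1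
  -- The mass of `(-b, b]` varies continuously from zero to the total mass, because there are no
  -- atoms; then the intermediate value theorem applies.
  have hc : Continuous fun b : ℝ => ∫ _ in (-b)..b, (1 : ℝ) ∂m := by
    have hp := intervalIntegral.continuous_primitive (μ := m) (f := fun _ => (1 : ℝ))
      (fun a b => hint.intervalIntegrable) 0
    have h := hp.sub (hp.comp continuous_neg)
    refine h.congr fun b => ?_
    exact intervalIntegral.integral_interval_sub_left hint.intervalIntegrable
      hint.intervalIntegrable
  have hlim : Tendsto (fun b : ℝ => ∫ _ in (-b)..b, (1 : ℝ) ∂m) atTop (𝓝 (m.real Set.univ)) := by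
    have h := intervalIntegral_tendsto_integral hint tendsto_neg_atTop_atBot tendsto_id
    simpa using h
  obtain ⟨b, hb, hb0⟩ := ((hlim.eventually (lt_mem_nhds h1)).and (eventually_ge_atTop 0)).exists
  obtain ⟨x, hx, hxc⟩ := intermediate_value_Icc hb0 hc.continuousOn
    (show c ∈ Set.Icc _ _ from ⟨by simpa using h0, hb.le⟩)
  refine ⟨Set.Ioc (-x) x, measurableSet_Ioc, ?_⟩
  rw [← hxc]
  simp only
  rw [intervalIntegral.integral_of_le (by linarith [hx.1])]
  simp

/-- A finite measure without atoms attains all intermediate values on the subsets of a set. -/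
theorem exists_subset_measureReal_eq {α : Type*} [MeasurableSpace α] [StandardBorelSpace α]
    (ν : Measure α) [IsFiniteMeasure ν] [NullSingletonClass ν] {A : Set α} (hA : MeasurableSet A)
    {c : ℝ} (h0 : 0 ≤ c) (h1 : c ≤ ν.real A) : ∃ B ⊆ A, MeasurableSet B ∧ ν.real B = c := by
  have he := measurableEmbedding_embeddingReal α
  set m := (ν.restrict A).map (embeddingReal α) with hm
  have hna : NullSingletonClass m := ⟨fun x => by
    rw [hm, Measure.map_apply he.measurable (measurableSet_singleton x)]
    exact (Set.subsingleton_singleton.preimage he.injective).measure_zero _⟩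
  have hreal : ∀ S, MeasurableSet S → m.real S = ν.real (embeddingReal α ⁻¹' S ∩ A) := by
    intro S hS
    rw [Measure.real, hm, Measure.map_apply he.measurable hS,
      Measure.restrict_apply (he.measurable hS), Measure.real]
  obtain ⟨S, hS, hSc⟩ := exists_measurableSet_measureReal_eq m h0 (by
    rw [hreal _ MeasurableSet.univ]; simpa using h1)
  exact ⟨_, Set.inter_subset_right, (he.measurable hS).inter hA, (hreal S hS).symm.trans hSc⟩

/-- On a probability space without atoms, every distribution on a finite set is the law of a random
variable. -/
theorem exists_measurable_measureReal_preimage_eq {α : Type*} [MeasurableSpace α]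
    [StandardBorelSpace α] (ν : Measure α) [IsProbabilityMeasure ν] [NullSingletonClass ν]
    {ι : Type*} [Fintype ι] (r : ι → ℝ) (h0 : ∀ i, 0 ≤ r i) (h1 : ∑ i, r i = 1) :
    ∃ X : α → ι, Measurable[_, ⊤] X ∧ ∀ i, ν.real (X ⁻¹' {i}) = r i := by
  classical
  -- The set `A` is split into pieces of the prescribed measures one at a time; it must vary in the
  -- induction, as each piece is removed from it.
  have main : ∀ s : Finset ι, s.Nonempty → ∀ A : Set α, MeasurableSet A →
      ν.real A = ∑ i ∈ s, r i → ∃ X : α → ι, (∀ i, MeasurableSet (X ⁻¹' {i})) ∧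
        (∀ z, X z ∈ s) ∧ ∀ i ∈ s, ν.real (A ∩ X ⁻¹' {i}) = r i := by
    intro s hs
    induction hs using Finset.Nonempty.cons_induction with
    | singleton a =>
      intro A hA hAr
      refine ⟨fun _ => a, fun i => MeasurableSet.const _, fun _ => Finset.mem_singleton_self a, ?_⟩
      intro i hi
      rw [Finset.mem_singleton] at hi
      subst hi
      simpa using hAr
    | cons a s ha hs ih =>
      intro A hA hAr
      rw [Finset.sum_cons] at hAr
      obtain ⟨B, hBA, hB, hBr⟩ := exists_subset_measureReal_eq ν hA (h0 a)
        (by rw [hAr]; exact le_add_of_nonneg_right (Finset.sum_nonneg fun i _ => h0 i))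
      obtain ⟨X, hX, hXs, hXr⟩ := ih (A \ B) (hA.diff hB) (by
        rw [measureReal_sdiff hBA hB, hBr, hAr]; ring)
      refine ⟨fun z => if z ∈ B then a else X z, fun i => ?_, fun z => ?_, fun i hi => ?_⟩
      · have : (fun z => if z ∈ B then a else X z) ⁻¹' {i} =
            (B ∩ {_z : α | a = i}) ∪ (Bᶜ ∩ X ⁻¹' {i}) := by
          ext z; by_cases hz : z ∈ B <;> simp [hz]
        rw [this]
        exact (hB.inter (MeasurableSet.const _)).union (hB.compl.inter (hX i))
      · by_cases hz : z ∈ B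
        · simp [hz]
        · simp [hz, hXs z]
      · rcases Finset.mem_cons.1 hi with rfl | hi
        · rw [← hBr]
          congr 1
          ext z
          by_cases hz : z ∈ B
          · simp [hz, hBA hz]
          · have : X z ≠ i := fun h => ha (h ▸ hXs z)
            simp [hz, this]
        · rw [← hXr i hi]
          congr 1
          ext z
          by_cases hz : z ∈ B
          · have : a ≠ i := fun h => ha (h ▸ hi)
            simp [hz, this]
          · simp [hz]
  have hne : (Finset.univ : Finset ι).Nonempty := by
    by_contra hne
    rw [Finset.not_nonempty_iff_eq_empty] at hne
    rw [hne, Finset.sum_empty] at h1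
    exact zero_ne_one h1
  obtain ⟨X, hX, -, hXr⟩ := main Finset.univ hne Set.univ MeasurableSet.univ (by simpa using h1.symm)
  refine ⟨X, ?_, fun i => by simpa using hXr i (Finset.mem_univ i)⟩
  let _ : MeasurableSpace ι := ⊤
  exact measurable_to_countable' hX

theorem integral_pi_eval {ι α : Type*} [Fintype ι] [MeasurableSpace α] (ν : Measure α)
    [IsProbabilityMeasure ν] (i : ι) {f : α → ℝ} (hf : Measurable f) :
    ∫ W, f (W i) ∂(Measure.pi fun _ : ι => ν) = ∫ z, f z ∂ν := by
  have hm := measurePreserving_eval (fun _ : ι => ν) i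
  have h := integral_map (f := f) (μ := Measure.pi fun _ : ι => ν) hm.measurable.aemeasurable hf.aestronglyMeasurable
  rw [hm.map_eq] at h
  exact h.symm

theorem integral_pi_mul {ι α : Type*} [Fintype ι] [MeasurableSpace α] (ν : Measure α)
    [IsProbabilityMeasure ν] {i j : ι} (hij : i ≠ j) {f g : α → ℝ} (hf : Measurable f)
    (hg : Measurable g) :
    ∫ W, f (W i) * g (W j) ∂(Measure.pi fun _ : ι => ν) = (∫ z, f z ∂ν) * ∫ z, g z ∂ν := by
  have hind := (ProbabilityTheory.iIndepFun_pi (μ := fun _ : ι => ν) (X := fun _ z => z)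
    fun _ => aemeasurable_id).indepFun hij
  rw [← integral_pi_eval ν i hf, ← integral_pi_eval ν j hg]
  exact (hind.comp hf hg).integral_fun_mul_eq_mul_integral
    (hf.comp (measurable_pi_apply i)).aestronglyMeasurable
    (hg.comp (measurable_pi_apply j)).aestronglyMeasurable

/-- The expectation of a function of a random variable with finitely many values. -/
theorem integral_comp_eq_sum {α ι : Type*} [MeasurableSpace α] (μ : Measure α)
    [IsFiniteMeasure μ] [Fintype ι] {X : α → ι} (hX : Measurable[_, ⊤] X) (F : ι → ℝ) :
    ∫ z, F (X z) ∂μ = ∑ i, μ.real (X ⁻¹' {i}) * F i := by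
  classical
  have hms : ∀ i, MeasurableSet (X ⁻¹' {i}) := fun i => hX trivial
  have : ∀ z, F (X z) = ∑ i, (X ⁻¹' {i}).indicator (fun _ => F i) z := by
    intro z; simp [Set.indicator_apply]
  simp_rw [this]
  rw [integral_finsetSum _ fun i _ => (integrable_const (F i)).indicator (hms i)]
  exact Finset.sum_congr rfl fun i _ => by rw [integral_indicator_const _ (hms i), smul_eq_mul]

/-- Since `1 + c * x ≤ (1 + c) * (1 + x)`, the dependence on the power separates from the fading.
This gives integrability, and later a bound uniform in `P`. -/
theorem log_one_add_mul_le {c x : ℝ} (hc : 0 ≤ c) (hx : 0 ≤ x) :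
    Real.log (1 + c * x) ≤ Real.log (1 + c) + Real.log (1 + x) := by
  rw [← Real.log_mul (by positivity) (by positivity)]
  exact Real.log_le_log (by positivity) (by nlinarith)

/-- For `P > 1` the argument lies between `c * P` and `(1 + c) * P`, so constant gains do not affect
the first order. -/
theorem tendsto_log_one_add_mul_div_log {c : ℝ} (hc : 0 < c) :
    Tendsto (fun P : ℝ => Real.log (1 + c * P) / Real.log P) atTop (𝓝 1) := by
  have h : ∀ a : ℝ, Tendsto (fun P : ℝ => (a + Real.log P) / Real.log P) atTop (𝓝 1) := by
    intro a
    have h1 : Tendsto (fun P : ℝ => a / Real.log P + 1) atTop (𝓝 (0 + 1)) :=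
      (Real.tendsto_log_atTop.const_div_atTop a).add_const 1
    rw [zero_add] at h1
    refine h1.congr' ?_
    filter_upwards [eventually_gt_atTop 1] with P hP
    rw [add_div, div_self (Real.log_pos hP).ne']
  refine tendsto_of_tendsto_of_tendsto_of_le_of_le' (h (Real.log c)) (h (Real.log (1 + c))) ?_ ?_
  · filter_upwards [eventually_gt_atTop 1] with P hP
    have hP0 : 0 < P := one_pos.trans hP
    refine div_le_div_of_nonneg_right ?_ (Real.log_pos hP).le
    rw [← Real.log_mul hc.ne' hP0.ne']
    exact Real.log_le_log (by positivity) (by linarith)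
  · filter_upwards [eventually_gt_atTop 1] with P hP
    have hP0 : 0 < P := one_pos.trans hP
    refine div_le_div_of_nonneg_right ?_ (Real.log_pos hP).le
    rw [← Real.log_mul (by positivity) hP0.ne']
    exact Real.log_le_log (by positivity) (by nlinarith)

/-! ### Mutual information of scheduling policies and time sharing between independent sets. -/

namespace HetNet

noncomputable section

open scoped Classical

set_option linter.unusedSectionVars false

variable {M Q U : Type*} [Fintype M] [Fintype Q] [Fintype U] {N : HetNet M Q U}
  {p : M ⊕ Q → ℝ} {ν : Measure ℂ} [IsProbabilityMeasure ν]

variable (N) in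
/-- The mean rate of a user in the absence of interference. -/
def meanRate (ν : Measure ℂ) (p : M ⊕ Q → ℝ) (k : N.BUser) : ℝ :=
  ∫ z, Real.log (1 + ‖(N.sigma k (N.serve k) : ℂ) * z‖ ^ 2 * p (N.serve k)) ∂ν

theorem norm_csi_sq (W : CSI M Q U) (k : U) (n : M ⊕ Q) :
    ‖N.csi W (k, n)‖ ^ 2 = N.sigma k n ^ 2 * ‖W (k, n)‖ ^ 2 := by
  simp [csi, mul_pow]

theorem measurable_csi : Measurable N.csi :=
  measurable_pi_lambda _ fun x => (measurable_pi_apply x).const_mul _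

theorem one_le_noise (hp : ∀ n, 0 < p (Sum.inl n)) (a : Pattern M) (h : CSI M Q U) (k : U) :
    1 ≤ N.noise p a h k := by
  refine le_add_of_nonneg_right (Finset.sum_nonneg fun n _ => ?_)
  split_ifs
  · exact mul_nonneg (sq_nonneg _) (hp n).le
  · exact le_rfl

/-- Every transmitting macro base station serves a member of `V`; if it is linked to `k`,
independence makes that member `k` itself. -/
theorem noise_eq_one {V : Finset N.BUser} (hV : N.IsMIS V) (h : CSI M Q U) {k : N.BUser}
    (hk : k ∈ V) : N.noise p (N.patternOf V) h k = 1 := by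
  refine add_eq_left.2 (Finset.sum_eq_zero fun n _ => if_neg ?_)
  rintro ⟨h1, h2, h3⟩
  obtain ⟨k', hk', hn⟩ := of_decide_eq_true h3
  have := hV.eq_of_edge hk hk' (hn ▸ h1)
  exact h2 (this ▸ hn)

theorem mutualInfo_nonneg (hp : ∀ n, 0 < p (Sum.inl n)) (a : Pattern M) (h : CSI M Q U)
    (ρ : U → Bool) (k : N.BUser) : 0 ≤ N.mutualInfo p a h ρ k := by
  unfold mutualInfo
  split_ifs
  · refine Real.log_nonneg (le_add_of_nonneg_right (div_nonneg ?_ ?_))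
    · exact mul_nonneg (sq_nonneg _) (serve_power_pos hp k).le
    · exact zero_le_one.trans (one_le_noise hp a h k)
  · exact le_rfl

theorem mutualInfo_le (hp : ∀ n, 0 < p (Sum.inl n)) (a : Pattern M) (h : CSI M Q U)
    (ρ : U → Bool) (k : N.BUser) :
    N.mutualInfo p a h ρ k ≤ Real.log (1 + ‖h (k, N.serve k)‖ ^ 2 * p (N.serve k)) := by
  have h0 := mul_nonneg (sq_nonneg ‖h (k, N.serve k)‖) (serve_power_pos hp k).le
  have h1 := one_le_noise hp (N := N) a h k
  unfold mutualInfo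
  split_ifs
  · refine Real.log_le_log ?_ (add_le_add_right (div_le_self h0 h1) 1)
    have := div_nonneg h0 (zero_le_one.trans h1)
    linarith
  · exact Real.log_nonneg (by linarith)

theorem measurable_mutualInfo (a : Pattern M) {ρ : CSI M Q U → U → Bool} (hρ : Measurable ρ)
    (k : U) : Measurable fun W : CSI M Q U => N.mutualInfo p a (N.csi W) (ρ (N.csi W)) k := by
  have hρk : Measurable fun W : CSI M Q U => ρ (N.csi W) k :=
    (measurable_pi_apply k).comp (hρ.comp measurable_csi)
  have hcoord : ∀ x, Measurable fun W : CSI M Q U => ‖N.csi W x‖ ^ 2 := fun x =>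
    (((measurable_pi_apply x).comp measurable_csi).norm).pow_const 2
  have hnoise : Measurable fun W : CSI M Q U => N.noise p a (N.csi W) k := by
    refine measurable_const.add (Finset.measurable_sum _ fun n _ => ?_)
    split_ifs
    · exact (hcoord _).mul_const _
    · exact measurable_const
  refine Measurable.ite (hρk (measurableSet_singleton true)) ?_ measurable_const
  exact (measurable_const.add (((hcoord _).mul_const _).div hnoise)).log

theorem integrable_log_eval (hν : Integrable (fun z : ℂ => Real.log (1 + ‖z‖ ^ 2)) ν)
    (x : U × (M ⊕ Q)) : Integrable (fun W : CSI M Q U => Real.log (1 + ‖W x‖ ^ 2))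
      (Measure.pi fun _ : U × (M ⊕ Q) => ν) :=
  (measurePreserving_eval (fun _ : U × (M ⊕ Q) => ν) x).integrable_comp_of_integrable hν

theorem log_gain_nonneg (hp : ∀ n, 0 < p (Sum.inl n)) (h : CSI M Q U) (k : N.BUser) :
    0 ≤ Real.log (1 + ‖h (k, N.serve k)‖ ^ 2 * p (N.serve k)) :=
  Real.log_nonneg (le_add_of_nonneg_right
    (mul_nonneg (sq_nonneg _) (serve_power_pos hp k).le))

theorem log_gain_le (hp : ∀ n, 0 < p (Sum.inl n)) (W : CSI M Q U) (k : N.BUser) :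
    Real.log (1 + ‖N.csi W (k, N.serve k)‖ ^ 2 * p (N.serve k)) ≤
      N.peakRate p k + Real.log (1 + ‖W (k, N.serve k)‖ ^ 2) := by
  rw [norm_csi_sq, mul_right_comm, mul_comm _ (p _)]
  exact log_one_add_mul_le (mul_nonneg (serve_power_pos hp k).le (sq_nonneg _)) (sq_nonneg _)

theorem measurable_log_gain (k : U) (n : M ⊕ Q) (c : ℝ) :
    Measurable fun W : CSI M Q U => Real.log (1 + ‖N.csi W (k, n)‖ ^ 2 * c) := by
  have := ((((measurable_pi_apply (k, n)).comp (measurable_csi (N := N))).norm).pow_const 2)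
  exact (measurable_const.add (this.mul_const c)).log

theorem integrable_log_gain (hν : Integrable (fun z : ℂ => Real.log (1 + ‖z‖ ^ 2)) ν)
    (hp : ∀ n, 0 < p (Sum.inl n)) (k : N.BUser) :
    Integrable (fun W : CSI M Q U => Real.log (1 + ‖N.csi W (k, N.serve k)‖ ^ 2 * p (N.serve k)))
      (Measure.pi fun _ : U × (M ⊕ Q) => ν) := by
  refine ((integrable_const (N.peakRate p k)).add (integrable_log_eval hν ((k : U), N.serve k))).mono'
    (measurable_log_gain _ _ _).aestronglyMeasurable (Eventually.of_forall fun W => ?_)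
  rw [Real.norm_of_nonneg (log_gain_nonneg hp _ k)]
  exact log_gain_le hp W k

theorem integrable_mutualInfo (hν : Integrable (fun z : ℂ => Real.log (1 + ‖z‖ ^ 2)) ν)
    (hp : ∀ n, 0 < p (Sum.inl n)) (a : Pattern M) {ρ : CSI M Q U → U → Bool} (hρ : Measurable ρ)
    (k : N.BUser) : Integrable (fun W => N.mutualInfo p a (N.csi W) (ρ (N.csi W)) k)
      (Measure.pi fun _ : U × (M ⊕ Q) => ν) := by
  refine (integrable_log_gain hν hp k).mono'
    (measurable_mutualInfo a hρ k).aestronglyMeasurable (Eventually.of_forall fun W => ?_)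
  rw [Real.norm_of_nonneg (mutualInfo_nonneg hp _ _ _ k)]
  exact mutualInfo_le hp _ _ _ k

theorem meanRate_eq (ν : Measure ℂ) [IsProbabilityMeasure ν] (p : M ⊕ Q → ℝ) (k : N.BUser) :
    N.meanRate ν p k =
      ∫ W, Real.log (1 + ‖N.csi W (k, N.serve k)‖ ^ 2 * p (N.serve k))
        ∂(Measure.pi fun _ : U × (M ⊕ Q) => ν) := by
  have hm : Measurable fun z : ℂ =>
      Real.log (1 + ‖(N.sigma k (N.serve k) : ℂ) * z‖ ^ 2 * p (N.serve k)) := by fun_prop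
  exact (integral_pi_eval ν ((k : U), N.serve k) hm).symm

/-- The coefficient is almost surely nonzero because the law has no atoms. Positivity keeps rates in
the domain when peak rates are replaced by mean rates. -/
theorem meanRate_pos [NullSingletonClass ν]
    (hν : Integrable (fun z : ℂ => Real.log (1 + ‖z‖ ^ 2)) ν)
    (hp : ∀ n, 0 < p (Sum.inl n)) (k : N.BUser) : 0 < N.meanRate ν p k := by
  rw [meanRate_eq]
  refine (integral_pos_iff_support_of_nonneg (fun W => log_gain_nonneg hp _ k)
    (integrable_log_gain hν hp k)).2 ?_
  have hae : ∀ᵐ W ∂(Measure.pi fun _ : U × (M ⊕ Q) => ν), W ∈ Function.support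
      fun W : CSI M Q U => Real.log (1 + ‖N.csi W (k, N.serve k)‖ ^ 2 * p (N.serve k)) := by
    filter_upwards [Measure.ae_eval_ne (fun _ : U × (M ⊕ Q) => ν) ((k : U), N.serve k) 0] with W hW
    refine (Real.log_pos (lt_add_of_pos_right _ (mul_pos ?_ (serve_power_pos hp k)))).ne'
    rw [norm_csi_sq]
    exact mul_pos (pow_pos (N.sigma_pos _ _) 2) (pow_pos (norm_pos_iff.2 hW) 2)
  rw [measure_eq_measure_of_null_sdiff (Set.subset_univ _)]
  · simp
  · rw [← Set.compl_eq_univ_sdiff]; exact hae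

/-! ### Achievability -/

variable (N) in
/-- The distribution of the pattern of a random set of users. -/
def patternLaw (q : Finset N.BUser → ℝ) (a : Pattern M) : ℝ :=
  ∑ V, if N.patternOf V = a then q V else 0

variable (N) in
/-- The policy that selects a maximal independent set by means of the coefficient of the link `x`
and the maps `X a`, and schedules it if it has the right pattern. -/
def misPolicy (x : U × (M ⊕ Q)) (X : Pattern M → ℂ → Finset N.BUser)
    (hX : ∀ a, Measurable[_, ⊤] (X a)) : N.SchedPolicy where
  -- A policy sees the scaled channel; dividing by `sigma` recovers the fading coefficient, whose
  -- law is `ν`.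
  toFun a h k := decide (∃ hk : N.IsTypeB k, (⟨k, hk⟩ : N.BUser) ∈ X a (h x / N.sigma x.1 x.2) ∧
    N.IsMIS (X a (h x / N.sigma x.1 x.2)) ∧ N.patternOf (X a (h x / N.sigma x.1 x.2)) = a)
  measurable_toFun a := by
    refine measurable_pi_lambda _ fun k => ?_
    have h1 : Measurable fun h : CSI M Q U => h x / N.sigma x.1 x.2 :=
      (measurable_pi_apply x).div_const _
    have h2 : Measurable[⊤] fun V : Finset N.BUser => decide (∃ hk : N.IsTypeB k,
      (⟨k, hk⟩ : N.BUser) ∈ V ∧ N.IsMIS V ∧ N.patternOf V = a) := measurable_from_top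
    exact @Measurable.comp _ _ _ _ ⊤ _ _ _ h2 ((hX a).comp h1)
  feasible a h := by
    refine ⟨fun k k' hk hk' hs => ?_, fun k hk => ?_, fun k n hk hn => ?_⟩
    · obtain ⟨hB, h1, h2, -⟩ := of_decide_eq_true hk
      obtain ⟨hB', h1', -, -⟩ := of_decide_eq_true hk'
      have := h2.eq_of_edge h1 h1' (by
        change N.edge k (N.serve k'); rw [← hs]; exact N.edge_serve k)
      exact congrArg Subtype.val this
    · exact (of_decide_eq_true hk).1
    · obtain ⟨hB, h1, -, h3⟩ := of_decide_eq_true hk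
      have : N.patternOf (X a (h x / N.sigma x.1 x.2)) n = true := decide_eq_true ⟨_, h1, hn⟩
      rwa [h3] at this

theorem mutualInfo_misPolicy {x : U × (M ⊕ Q)} {X : Pattern M → ℂ → Finset N.BUser}
    (hX : ∀ a, Measurable[_, ⊤] (X a)) (a : Pattern M) (W : CSI M Q U) (k : N.BUser) :
    N.mutualInfo p a (N.csi W) ((N.misPolicy x X hX).toFun a (N.csi W)) k =
      (if k ∈ X a (W x) ∧ N.IsMIS (X a (W x)) ∧ N.patternOf (X a (W x)) = a then 1 else 0) *
        Real.log (1 + ‖(N.sigma k (N.serve k) : ℂ) * W (k, N.serve k)‖ ^ 2 * p (N.serve k)) := by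
  have hx : N.csi W x / N.sigma x.1 x.2 = W x :=
    mul_div_cancel_left₀ _ (Complex.ofReal_ne_zero.2 (N.sigma_pos _ _).ne')
  have hiff : (N.misPolicy x X hX).toFun a (N.csi W) k = true ↔
      k ∈ X a (W x) ∧ N.IsMIS (X a (W x)) ∧ N.patternOf (X a (W x)) = a := by
    simp only [misPolicy, decide_eq_true_eq, hx]
    exact ⟨fun ⟨_, h⟩ => h, fun h => ⟨k.2, h⟩⟩
  unfold mutualInfo
  by_cases h : k ∈ X a (W x) ∧ N.IsMIS (X a (W x)) ∧ N.patternOf (X a (W x)) = a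
  · rw [if_pos (hiff.2 h), if_pos h, one_mul]
    have := noise_eq_one (p := p) h.2.1 (N.csi W) h.1
    rw [h.2.2] at this
    rw [this, div_one]
    rfl
  · rw [if_neg (fun h' => h (hiff.1 h')), if_neg h, zero_mul]

/-- Time sharing between maximal independent sets is achieved by a scheduling policy: as there are
at least two links to each type B user, the coefficient of a link that carries no data serves as
a source of randomness. -/
theorem exists_policy [Nonempty N.BUser] (ν : Measure ℂ) [IsProbabilityMeasure ν]
    [NullSingletonClass ν] {q : Finset N.BUser → ℝ} (h0 : ∀ V, 0 ≤ q V)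
    (hM : ∀ V, q V ≠ 0 → N.IsMIS V) :
    ∃ π : N.SchedPolicy, ∀ (p : M ⊕ Q → ℝ) (k : N.BUser), N.avgInfo ν p (N.patternLaw q) π k =
      (∑ V, if k ∈ V then q V else 0) * N.meanRate ν p k := by
  obtain ⟨k₀⟩ := ‹Nonempty N.BUser›
  obtain ⟨n₀, -, hn₀⟩ := exists_edge_ne_serve k₀
  -- For a pattern `a` of positive probability, `X a` has the conditional law of `V` given that its
  -- pattern is `a`.
  have hX : ∀ a, ∃ X : ℂ → Finset N.BUser, Measurable[_, ⊤] X ∧ (N.patternLaw q a ≠ 0 →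
      ∀ V, ν.real (X ⁻¹' {V}) = (if N.patternOf V = a then q V else 0) / N.patternLaw q a) := by
    intro a
    by_cases ha : N.patternLaw q a = 0
    · exact ⟨fun _ => ∅, measurable_const, fun h => absurd ha h⟩
    · have hite : ∀ V, 0 ≤ if N.patternOf V = a then q V else 0 := fun V => by
        split_ifs; exacts [h0 V, le_rfl]
      obtain ⟨X, hX, hXr⟩ := exists_measurable_measureReal_preimage_eq ν
        (fun V => (if N.patternOf V = a then q V else 0) / N.patternLaw q a)
        (fun V => div_nonneg (hite V) (Finset.sum_nonneg fun V _ => hite V))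
        (by rw [← Finset.sum_div]; exact div_self ha)
      exact ⟨X, hX, fun _ => hXr⟩
  choose X hXm hXr using hX
  refine ⟨N.misPolicy ((k₀ : U), n₀) X hXm, fun p k => ?_⟩
  -- The selecting link is not the serving link of any user, so the selection is independent of the
  -- direct gain in the rate; interference is absent for the scheduled set.
  have hne : ((k₀ : U), n₀) ≠ ((k : U), N.serve k) := by
    intro h
    have h1 := congrArg Prod.fst h
    have h2 := congrArg Prod.snd h
    simp only at h1 h2
    rw [← h1] at h2
    exact hn₀ h2
  have hm : Measurable fun z : ℂ =>
      Real.log (1 + ‖(N.sigma k (N.serve k) : ℂ) * z‖ ^ 2 * p (N.serve k)) := by fun_prop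
  have key : ∀ a, N.patternLaw q a * N.meanInfo ν p (N.misPolicy ((k₀ : U), n₀) X hXm) a k =
      (∑ V, if N.patternOf V = a then (if k ∈ V then q V else 0) else 0) * N.meanRate ν p k := by
    intro a
    by_cases ha : N.patternLaw q a = 0
    · rw [ha, zero_mul, eq_comm, mul_eq_zero]
      left
      refine Finset.sum_eq_zero fun V _ => ?_
      have hz := (Finset.sum_eq_zero_iff_of_nonneg (fun V _ => by
        split_ifs; exacts [h0 V, le_rfl])).1 ha V (Finset.mem_univ V)
      by_cases h1 : N.patternOf V = a
      · rw [if_pos h1] at hz ⊢; rw [hz, ite_self]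
      · rw [if_neg h1]
    · have hf : Measurable fun z : ℂ => (if k ∈ X a z ∧ N.IsMIS (X a z) ∧ N.patternOf (X a z) = a
          then (1 : ℝ) else 0) := by
        have h2 : Measurable[⊤] fun V : Finset N.BUser =>
          if k ∈ V ∧ N.IsMIS V ∧ N.patternOf V = a then (1 : ℝ) else 0 := measurable_from_top
        exact @Measurable.comp _ _ _ _ ⊤ _ _ _ h2 (hXm a)
      unfold meanInfo
      simp only [mutualInfo_misPolicy]
      rw [integral_pi_mul ν hne hf hm, integral_comp_eq_sum ν (hXm a)
        (fun V => if k ∈ V ∧ N.IsMIS V ∧ N.patternOf V = a then (1 : ℝ) else 0), ← mul_assoc,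
        Finset.mul_sum]
      congr 1
      refine Finset.sum_congr rfl fun V _ => ?_
      rw [hXr a ha V]
      by_cases h1 : N.patternOf V = a
      · by_cases h2 : k ∈ V
        · by_cases h3 : q V = 0
          · simp [h3]
          · simp [h1, h2, hM V h3]; field_simp
        · simp [h2]
      · simp [h1]
  unfold avgInfo
  rw [Finset.sum_congr rfl fun a _ => key a, ← Finset.sum_mul, Finset.sum_comm]
  simp

theorem patternLaw_nonneg {q : Finset N.BUser → ℝ} (h0 : ∀ V, 0 ≤ q V) (a : Pattern M) :
    0 ≤ N.patternLaw q a :=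
  Finset.sum_nonneg fun V _ => by split_ifs; exacts [h0 V, le_rfl]

theorem isControl_patternLaw {Θ : Finset (Finset N.BUser)} {q : Finset N.BUser → ℝ}
    (h0 : ∀ V, 0 ≤ q V) (h1 : ∀ V, V ∉ Θ → q V = 0) (h2 : ∑ V ∈ Θ, q V = 1) :
    IsControl (N.outputProfile Θ q) (N.patternLaw q) := by
  refine ⟨patternLaw_nonneg h0, ?_, fun a ha => Finset.sum_eq_zero fun V _ => ?_⟩
  · unfold patternLaw
    rw [Finset.sum_comm]
    have := sum_eq_sum_univ (N := N) h1 fun _ => 1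
    simp only [mul_one, h2] at this
    simp [← this]
  · by_contra hne
    obtain ⟨h3, h4⟩ := ite_ne_right_iff.1 hne
    refine ha (Finset.mem_image.2 ⟨V, Finset.mem_filter.2 ⟨?_, (h0 V).lt_of_ne' h4⟩, h3⟩)
    by_contra h5
    exact h4 (h1 V h5)

/-- The factor is the fraction of time of user `k`. The same factor multiplies `meanRate` in
`exists_policy`, so the two rates differ by a ratio independent of `q`. -/
theorem mixRate_eq_mul_peakRate {Θ : Finset (Finset N.BUser)} {q : Finset N.BUser → ℝ}
    (h1 : ∀ V, V ∉ Θ → q V = 0) (k : N.BUser) :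
    N.mixRate p Θ q k = (∑ V, if k ∈ V then q V else 0) * N.peakRate p k := by
  rw [mixRate, sum_eq_sum_univ h1, Finset.sum_mul]
  refine Finset.sum_congr rfl fun V _ => ?_
  by_cases h : k ∈ V
  · rw [detRate_of_mem h, if_pos h]
  · simp [detRate, h]

end

end HetNet

/-! ### Upper bound for arbitrary policies and the size of its error. -/

namespace HetNet

noncomputable section

open scoped Classical

set_option linter.unusedSectionVars false

variable {M Q U : Type*} [Fintype M] [Fintype Q] [Fintype U] {N : HetNet M Q U}
  {p : M ⊕ Q → ℝ} {ν : Measure ℂ} [IsProbabilityMeasure ν]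

/-! ### Converse -/

variable (N) in
/-- The scheduled users that do not suffer interference. -/
def unblocked (ρ : U → Bool) : Finset N.BUser :=
  {k | ρ k = true ∧ ∀ k' : U, ρ k' = true → k' ≠ k → ¬ N.edge k (N.serve k')}

theorem isIndepSet_unblocked (ρ : U → Bool) :
    N.interferenceGraph.IsIndepSet (N.unblocked ρ : Set N.BUser) := by
  intro k hk k' hk' hne hadj
  simp only [unblocked, Finset.coe_filter, Finset.mem_univ, true_and, Set.mem_ofPred_eq] at hk hk'
  rcases hadj.2 with h | h
  · exact hk.2 k' hk'.1 (fun h => hne (Subtype.ext h.symm)) h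
  · exact hk'.2 k hk.1 (fun h => hne (Subtype.ext h)) h

variable (N) in
/-- A maximal independent set that contains all scheduled users without interference. -/
def unblockedMIS (ρ : U → Bool) : Finset N.BUser :=
  (exists_isMIS_superset (isIndepSet_unblocked (N := N) ρ)).choose

theorem isMIS_unblockedMIS (ρ : U → Bool) : N.IsMIS (N.unblockedMIS ρ) :=
  (exists_isMIS_superset (isIndepSet_unblocked ρ)).choose_spec.1

theorem unblocked_subset (ρ : U → Bool) : N.unblocked ρ ⊆ N.unblockedMIS ρ :=
  (exists_isMIS_superset (isIndepSet_unblocked ρ)).choose_spec.2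

variable (N) in
/-- The fluctuation of the rate of user `k` without interference, plus its rates in the presence of
a single interferer. -/
def excess (p : M ⊕ Q → ℝ) (h : CSI M Q U) (k : N.BUser) : ℝ :=
  |Real.log (1 + ‖h (k, N.serve k)‖ ^ 2 * p (N.serve k)) - N.peakRate p k| +
    ∑ n : M, if N.edge k (Sum.inl n) ∧ N.serve k ≠ Sum.inl n then
      Real.log (1 + ‖h (k, N.serve k)‖ ^ 2 * p (N.serve k) /
        (1 + ‖h (k, Sum.inl n)‖ ^ 2 * p (Sum.inl n))) else 0

theorem interfered_nonneg (hp : ∀ n, 0 < p (Sum.inl n)) (h : CSI M Q U) (k : N.BUser) (n : M) :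
    0 ≤ Real.log (1 + ‖h (k, N.serve k)‖ ^ 2 * p (N.serve k) /
        (1 + ‖h (k, Sum.inl n)‖ ^ 2 * p (Sum.inl n))) :=
  Real.log_nonneg (le_add_of_nonneg_right (div_nonneg
    (mul_nonneg (sq_nonneg _) (serve_power_pos hp k).le)
    (add_nonneg zero_le_one (mul_nonneg (sq_nonneg _) (hp n).le))))

theorem interfered_le (hp : ∀ n, 0 < p (Sum.inl n)) (h : CSI M Q U) (k : N.BUser) (n : M) :
    Real.log (1 + ‖h (k, N.serve k)‖ ^ 2 * p (N.serve k) /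
        (1 + ‖h (k, Sum.inl n)‖ ^ 2 * p (Sum.inl n))) ≤
      Real.log (1 + ‖h (k, N.serve k)‖ ^ 2 * p (N.serve k)) := by
  have h0 := mul_nonneg (sq_nonneg ‖h (k, N.serve k)‖) (serve_power_pos hp k).le
  have h1 := mul_nonneg (sq_nonneg ‖h (k, Sum.inl n)‖) (hp n).le
  have h2 : 0 ≤ ‖h (k, N.serve k)‖ ^ 2 * p (N.serve k) /
    (1 + ‖h (k, Sum.inl n)‖ ^ 2 * p (Sum.inl n)) := div_nonneg h0 (by linarith)
  exact Real.log_le_log (by linarith) (add_le_add_right (div_le_self h0 (by linarith)) 1)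

theorem interferers_nonneg (hp : ∀ n, 0 < p (Sum.inl n)) (h : CSI M Q U) (k : N.BUser) (n : M) :
    0 ≤ if N.edge k (Sum.inl n) ∧ N.serve k ≠ Sum.inl n then
      Real.log (1 + ‖h (k, N.serve k)‖ ^ 2 * p (N.serve k) /
        (1 + ‖h (k, Sum.inl n)‖ ^ 2 * p (Sum.inl n))) else 0 := by
  split_ifs
  · exact interfered_nonneg hp h k n
  · exact le_rfl

theorem excess_nonneg (hp : ∀ n, 0 < p (Sum.inl n)) (h : CSI M Q U) (k : N.BUser) :
    0 ≤ N.excess p h k :=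
  add_nonneg (abs_nonneg _) (Finset.sum_nonneg fun n _ => interferers_nonneg hp h k n)

/-- A user in `unblocked` gets at most its peak rate plus the fluctuation. Any other scheduled user
suffers from at least one active interferer, and the sum in `excess` contains its rate against that
interferer alone. -/
theorem mutualInfo_le_add_excess (hp : ∀ n, 0 < p (Sum.inl n)) {a : Pattern M} {ρ : U → Bool}
    (hρ : N.FeasibleSchedule a ρ) (h : CSI M Q U) (k : N.BUser) :
    N.mutualInfo p a h ρ k ≤ N.detRate p (N.unblockedMIS ρ) k + N.excess p h k := by
  have hdet := detRate_nonneg hp (N.unblockedMIS ρ) k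
  by_cases hk : ρ k = true
  swap
  · rw [mutualInfo, if_neg hk]; exact add_nonneg hdet (excess_nonneg hp h k)
  by_cases hu : k ∈ N.unblocked ρ
  · rw [detRate_of_mem (unblocked_subset ρ hu)]
    refine (mutualInfo_le hp a h ρ k).trans ?_
    have h1 := le_abs_self
      (Real.log (1 + ‖h (k, N.serve k)‖ ^ 2 * p (N.serve k)) - N.peakRate p k)
    have h2 := Finset.sum_nonneg fun n (_ : n ∈ Finset.univ) => interferers_nonneg hp h k n
    unfold excess
    linarith
  · simp only [unblocked, Finset.mem_filter, Finset.mem_univ, true_and] at hu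
    push Not at hu
    obtain ⟨k', hk', hne, hedge⟩ := hu hk
    -- The blocking user is scheduled, hence of type B: its server is a macro base station, switched
    -- on in `a`, and different from that of `k` by the one-user constraint.
    obtain ⟨n, hn⟩ := exists_serve_eq_inl (⟨k', hρ.2.1 k' hk'⟩ : N.BUser)
    change N.serve k' = Sum.inl n at hn
    rw [hn] at hedge
    have hserve : N.serve k ≠ Sum.inl n := fun h' => hne (hρ.1 k' k hk' hk (hn.trans h'.symm))
    have ha := hρ.2.2 k' n hk' hn
    have hterm : ∀ m : M, 0 ≤ if N.edge k (Sum.inl m) ∧ N.serve k ≠ Sum.inl m ∧ a m = true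
        then ‖h (k, Sum.inl m)‖ ^ 2 * p (Sum.inl m) else 0 := by
      intro m; split_ifs
      · exact mul_nonneg (sq_nonneg _) (hp m).le
      · exact le_rfl
    have hnoise : 1 + ‖h (k, Sum.inl n)‖ ^ 2 * p (Sum.inl n) ≤ N.noise p a h k := by
      refine add_le_add_right ?_ 1
      have := Finset.single_le_sum (fun m _ => hterm m) (Finset.mem_univ n)
      rwa [if_pos ⟨hedge, hserve, ha⟩] at this
    have h0 := mul_nonneg (sq_nonneg ‖h (k, N.serve k)‖) (serve_power_pos hp k).le
    have h1 := mul_nonneg (sq_nonneg ‖h (k, Sum.inl n)‖) (hp n).le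
    have hle : N.mutualInfo p a h ρ k ≤ Real.log (1 + ‖h (k, N.serve k)‖ ^ 2 * p (N.serve k) /
        (1 + ‖h (k, Sum.inl n)‖ ^ 2 * p (Sum.inl n))) := by
      rw [mutualInfo, if_pos hk]
      have h2 : 0 ≤ ‖h (k, N.serve k)‖ ^ 2 * p (N.serve k) / N.noise p a h k :=
        div_nonneg h0 (by linarith)
      refine Real.log_le_log (by linarith) (add_le_add_right ?_ 1)
      exact div_le_div_of_nonneg_left h0 (by linarith) hnoise
    have h3 := Finset.single_le_sum (fun m _ => interferers_nonneg hp h k m) (Finset.mem_univ n)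
    rw [if_pos ⟨hedge, hserve⟩] at h3
    have h4 := abs_nonneg
      (Real.log (1 + ‖h (k, N.serve k)‖ ^ 2 * p (N.serve k)) - N.peakRate p k)
    unfold excess
    linarith

variable (N) in
/-- The mean of the excess. -/
def gap (ν : Measure ℂ) (p : M ⊕ Q → ℝ) (k : N.BUser) : ℝ :=
  ∫ W, N.excess p (N.csi W) k ∂(Measure.pi fun _ : U × (M ⊕ Q) => ν)

theorem excess_le (hp : ∀ n, 0 < p (Sum.inl n)) (W : CSI M Q U) (k : N.BUser) :
    N.excess p (N.csi W) k ≤ (1 + Fintype.card M) *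
      (N.peakRate p k + Real.log (1 + ‖W (k, N.serve k)‖ ^ 2)) := by
  have h1 := log_gain_le hp W k
  have h2 := log_gain_nonneg hp (N.csi W) k
  have h3 := (peakRate_pos hp k).le
  have h4 : 0 ≤ Real.log (1 + ‖W (k, N.serve k)‖ ^ 2) :=
    Real.log_nonneg (le_add_of_nonneg_right (sq_nonneg _))
  have h5 : ∀ n : M, (if N.edge k (Sum.inl n) ∧ N.serve k ≠ Sum.inl n then
      Real.log (1 + ‖N.csi W (k, N.serve k)‖ ^ 2 * p (N.serve k) /
        (1 + ‖N.csi W (k, Sum.inl n)‖ ^ 2 * p (Sum.inl n))) else 0) ≤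
      N.peakRate p k + Real.log (1 + ‖W (k, N.serve k)‖ ^ 2) := by
    intro n
    split_ifs
    · exact (interfered_le hp _ k n).trans h1
    · exact add_nonneg h3 h4
  rw [add_mul, one_mul]
  refine add_le_add (abs_le.2 ⟨by linarith, by linarith⟩) ?_
  refine (Finset.sum_le_sum fun n _ => h5 n).trans ?_
  rw [Finset.sum_const, nsmul_eq_mul, Finset.card_univ]

theorem measurable_excess (p : M ⊕ Q → ℝ) (k : N.BUser) :
    Measurable fun W : CSI M Q U => N.excess p (N.csi W) k := by
  have hcoord : ∀ x, Measurable fun W : CSI M Q U => ‖N.csi W x‖ ^ 2 := fun x =>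
    (((measurable_pi_apply x).comp measurable_csi).norm).pow_const 2
  refine Measurable.add ?_ (Finset.measurable_sum _ fun n _ => ?_)
  · exact continuous_abs.measurable.comp ((measurable_log_gain _ _ _).sub measurable_const)
  · split_ifs
    · exact (measurable_const.add (((hcoord _).mul_const _).div
        (measurable_const.add ((hcoord _).mul_const _)))).log
    · exact measurable_const

theorem integrable_excess_bound (hν : Integrable (fun z : ℂ => Real.log (1 + ‖z‖ ^ 2)) ν)
    (c d : ℝ) (k : N.BUser) : Integrable
      (fun W : CSI M Q U => c * (d + Real.log (1 + ‖W (k, N.serve k)‖ ^ 2)))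
      (Measure.pi fun _ : U × (M ⊕ Q) => ν) :=
  ((integrable_const d).add (integrable_log_eval hν ((k : U), N.serve k))).const_mul c

theorem integrable_excess (hν : Integrable (fun z : ℂ => Real.log (1 + ‖z‖ ^ 2)) ν)
    (hp : ∀ n, 0 < p (Sum.inl n)) (k : N.BUser) :
    Integrable (fun W => N.excess p (N.csi W) k) (Measure.pi fun _ : U × (M ⊕ Q) => ν) := by
  refine (integrable_excess_bound hν (1 + Fintype.card M) (N.peakRate p k) k).mono'
    (measurable_excess p k).aestronglyMeasurable (Eventually.of_forall fun W => ?_)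
  rw [Real.norm_of_nonneg (excess_nonneg hp _ k)]
  exact excess_le hp W k

theorem gap_nonneg (hp : ∀ n, 0 < p (Sum.inl n)) (k : N.BUser) : 0 ≤ N.gap ν p k :=
  integral_nonneg fun _ => excess_nonneg hp _ k

/-- The fluctuation term of `excess` is an absolute value so that the same gap controls
achievability as well as the converse. -/
theorem peakRate_sub_gap_le (hν : Integrable (fun z : ℂ => Real.log (1 + ‖z‖ ^ 2)) ν)
    (hp : ∀ n, 0 < p (Sum.inl n)) (k : N.BUser) :
    N.peakRate p k - N.gap ν p k ≤ N.meanRate ν p k := by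
  rw [meanRate_eq, gap, sub_le_iff_le_add,
    ← integral_add (integrable_log_gain hν hp k) (integrable_excess hν hp k)]
  have h := integral_mono (μ := Measure.pi fun _ : U × (M ⊕ Q) => ν)
    (integrable_const (N.peakRate p k))
    ((integrable_log_gain hν hp k).add (integrable_excess hν hp k)) fun W => ?_
  · simpa using h
  · have h1 := neg_abs_le
      (Real.log (1 + ‖N.csi W (k, N.serve k)‖ ^ 2 * p (N.serve k)) - N.peakRate p k)
    have h2 := Finset.sum_nonneg fun n (_ : n ∈ Finset.univ) =>
      interferers_nonneg hp (N.csi W) k n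
    simp only [Pi.add_apply, excess]
    linarith

/-- Every control policy is dominated by a mixture of maximal independent sets, up to the gap. -/
theorem exists_avgInfo_le (hν : Integrable (fun z : ℂ => Real.log (1 + ‖z‖ ^ 2)) ν)
    (hp : ∀ n, 0 < p (Sum.inl n)) {𝒜 : Finset (Pattern M)} {r : Pattern M → ℝ}
    (hr : IsControl 𝒜 r) (π : N.SchedPolicy) :
    ∃ q : Finset N.BUser → ℝ, (∀ V, 0 ≤ q V) ∧ (∀ V, V ∉ N.allMIS → q V = 0) ∧
      ∑ V ∈ N.allMIS, q V = 1 ∧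
      ∀ k : N.BUser, N.avgInfo ν p r π k ≤ N.mixRate p N.allMIS q k + N.gap ν p k := by
  set μ := Measure.pi fun _ : U × (M ⊕ Q) => ν with hμ
  set X : Pattern M → CSI M Q U → Finset N.BUser := fun a W =>
    N.unblockedMIS (π.toFun a (N.csi W)) with hX
  have hXm : ∀ a, Measurable[_, ⊤] (X a) := fun a => by
    have h1 : Measurable[_, ⊤] (N.unblockedMIS) := @Measurable.of_discrete _ _ _ ⊤ _ _
    exact @Measurable.comp _ _ _ _ _ ⊤ _ _ h1 ((π.measurable_toFun a).comp measurable_csi)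
  -- The law of the random set `X`, averaged over the fading and the control `r`.
  set q : Finset N.BUser → ℝ := fun V => ∑ a, r a * μ.real (X a ⁻¹' {V}) with hq
  have hF : ∀ F : Finset N.BUser → ℝ, ∑ V, q V * F V = ∑ a, r a * ∫ W, F (X a W) ∂μ := by
    intro F
    simp only [integral_comp_eq_sum μ (hXm _) F, hq, Finset.sum_mul, Finset.mul_sum]
    rw [Finset.sum_comm]
    exact Finset.sum_congr rfl fun a _ => Finset.sum_congr rfl fun V _ => mul_assoc _ _ _
  have hq0 : ∀ V, V ∉ N.allMIS → q V = 0 := by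
    intro V hV
    refine Finset.sum_eq_zero fun a _ => ?_
    have : X a ⁻¹' {V} = ∅ := by
      refine Set.eq_empty_of_forall_notMem fun W hW => hV (mem_allMIS.2 ?_)
      rw [← show X a W = V from hW]
      exact isMIS_unblockedMIS _
    rw [this]; simp
  refine ⟨q, fun V => Finset.sum_nonneg fun a _ => mul_nonneg (hr.1 a) measureReal_nonneg, hq0,
    ?_, fun k => ?_⟩
  · have h1 := hF fun _ => 1
    have h2 := sum_eq_sum_univ hq0 fun _ => 1
    simp only [mul_one] at h1 h2
    rw [h2, h1]
    simpa using hr.2.1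
  · rw [mixRate, sum_eq_sum_univ hq0, hF fun V => N.detRate p V k]
    have hgap : N.gap ν p k = ∑ a, r a * N.gap ν p k := by
      rw [← Finset.sum_mul, hr.2.1, one_mul]
    rw [hgap, ← Finset.sum_add_distrib]
    refine Finset.sum_le_sum fun a _ => ?_
    rw [← mul_add]
    refine mul_le_mul_of_nonneg_left ?_ (hr.1 a)
    have hint : Integrable (fun W => N.detRate p (X a W) k) μ := by
      have hm : Measurable fun W => N.detRate p (X a W) k :=
        @Measurable.comp _ _ _ _ ⊤ _ (fun V => N.detRate p V k) _ measurable_from_top (hXm a)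
      refine (integrable_const (N.peakRate p k)).mono' hm.aestronglyMeasurable
        (Eventually.of_forall fun W => ?_)
      rw [Real.norm_of_nonneg (detRate_nonneg hp _ k)]
      by_cases h : k ∈ X a W
      · rw [detRate_of_mem h]
      · simp [detRate, h, (peakRate_pos hp k).le]
    rw [gap, ← integral_add hint (integrable_excess hν hp k)]
    exact integral_mono (integrable_mutualInfo hν hp a (π.measurable_toFun a) k)
      (hint.add (integrable_excess hν hp k))
      fun W => mutualInfo_le_add_excess hp (π.feasible a _) _ k

/-! ### High SNR -/

section HighSNR

variable {α : M → ℝ} {pw : ℝ → M ⊕ Q → ℝ}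

theorem tendsto_peakRate_div_log (hα : ∀ n, 0 < α n)
    (hpw : ∀ P n, pw P (Sum.inl n) = α n * P) (k : N.BUser) :
    Tendsto (fun P => N.peakRate (pw P) k / Real.log P) atTop (𝓝 1) := by
  obtain ⟨m, hm⟩ := exists_serve_eq_inl k
  have h := tendsto_log_one_add_mul_div_log
    (mul_pos (hα m) (pow_pos (N.sigma_pos k (N.serve k)) 2))
  refine h.congr fun P => ?_
  rw [peakRate, hm, hpw]
  ring_nf

theorem tendsto_peakRate_atTop (hα : ∀ n, 0 < α n)
    (hpw : ∀ P n, pw P (Sum.inl n) = α n * P) (k : N.BUser) :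
    Tendsto (fun P => N.peakRate (pw P) k) atTop atTop := by
  refine ((tendsto_peakRate_div_log hα hpw k).pos_mul_atTop one_pos
    Real.tendsto_log_atTop).congr' ?_
  filter_upwards [eventually_gt_atTop 1] with P hP
  exact div_mul_cancel₀ _ (Real.log_pos hP).ne'

/-- The direct rate and the peak rate share the growth `log P`, so their difference is of lower
order. Against an interferer the ratio of powers stays below `a / b`, so that rate is bounded. -/
theorem tendsto_excess_div_log (hα : ∀ n, 0 < α n)
    (hpw : ∀ P n, pw P (Sum.inl n) = α n * P) {W : CSI M Q U} (hW : ∀ x, W x ≠ 0)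
    (k : N.BUser) :
    Tendsto (fun P => N.excess (pw P) (N.csi W) k / Real.log P) atTop (𝓝 0) := by
  have hc : ∀ n, 0 < ‖N.csi W (k, n)‖ ^ 2 := fun n => by
    rw [norm_csi_sq]
    exact mul_pos (pow_pos (N.sigma_pos _ _) 2) (pow_pos (norm_pos_iff.2 (hW _)) 2)
  obtain ⟨m, hm⟩ := exists_serve_eq_inl k
  have hA : Tendsto (fun P => Real.log (1 + ‖N.csi W (k, N.serve k)‖ ^ 2 * pw P (N.serve k)) /
      Real.log P) atTop (𝓝 1) := by
    refine (tendsto_log_one_add_mul_div_log (mul_pos (hc (N.serve k)) (hα m))).congr fun P => ?_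
    rw [mul_assoc, ← hpw, ← hm]
  have h1 : Tendsto (fun P => |Real.log (1 + ‖N.csi W (k, N.serve k)‖ ^ 2 * pw P (N.serve k)) -
      N.peakRate (pw P) k| / Real.log P) atTop (𝓝 0) := by
    have h := (hA.sub (tendsto_peakRate_div_log hα hpw k)).abs
    rw [sub_self, abs_zero] at h
    refine h.congr' ?_
    filter_upwards [eventually_gt_atTop 1] with P hP
    rw [← sub_div, abs_div, abs_of_pos (Real.log_pos hP)]
  have h2 : ∀ n : M, Tendsto (fun P => (if N.edge k (Sum.inl n) ∧ N.serve k ≠ Sum.inl n then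
      Real.log (1 + ‖N.csi W (k, N.serve k)‖ ^ 2 * pw P (N.serve k) /
        (1 + ‖N.csi W (k, Sum.inl n)‖ ^ 2 * pw P (Sum.inl n))) else 0) / Real.log P)
      atTop (𝓝 0) := by
    intro n
    split_ifs
    swap
    · simp
    set a := ‖N.csi W (k, N.serve k)‖ ^ 2 * α m with ha
    set b := ‖N.csi W (k, Sum.inl n)‖ ^ 2 * α n with hb
    have ha0 : 0 < a := mul_pos (hc _) (hα m)
    have hb0 : 0 < b := mul_pos (hc _) (hα n)
    refine tendsto_of_tendsto_of_tendsto_of_le_of_le' tendsto_const_nhds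
      (Real.tendsto_log_atTop.const_div_atTop (Real.log (1 + a / b))) ?_ ?_
    all_goals
      filter_upwards [eventually_gt_atTop 1] with P hP
      have hP0 : 0 < P := one_pos.trans hP
      rw [show pw P (N.serve k) = α m * P by rw [hm, hpw], hpw, ← mul_assoc, ← mul_assoc, ← ha,
        ← hb]
    · exact div_nonneg (Real.log_nonneg (le_add_of_nonneg_right (by positivity)))
        (Real.log_pos hP).le
    · refine div_le_div_of_nonneg_right (Real.log_le_log (by positivity) ?_) (Real.log_pos hP).le
      refine add_le_add_right ?_ 1
      rw [div_le_div_iff₀ (by positivity) hb0]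
      nlinarith
  have h := h1.add (tendsto_finsetSum Finset.univ fun n _ => h2 n)
  simp only [Finset.sum_const_zero, add_zero] at h
  refine h.congr fun P => ?_
  rw [excess, add_div, Finset.sum_div]

theorem tendsto_gap_div_log [NullSingletonClass ν]
    (hν : Integrable (fun z : ℂ => Real.log (1 + ‖z‖ ^ 2)) ν) (hα : ∀ n, 0 < α n)
    (hpw : ∀ P n, pw P (Sum.inl n) = α n * P) (k : N.BUser) :
    Tendsto (fun P => N.gap ν (pw P) k / Real.log P) atTop (𝓝 0) := by
  have h := tendsto_integral_filter_of_dominated_convergence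
    (μ := Measure.pi fun _ : U × (M ⊕ Q) => ν) (l := atTop) (f := fun _ => 0)
    (F := fun P W => N.excess (pw P) (N.csi W) k / Real.log P)
    (fun W => (1 + Fintype.card M) * (2 + Real.log (1 + ‖W ((k : U), N.serve k)‖ ^ 2)))
    (Eventually.of_forall fun P => ((measurable_excess _ k).div_const _).aestronglyMeasurable) ?_
    (integrable_excess_bound hν _ _ k) ?_
  · rw [integral_zero] at h
    exact h.congr fun P => integral_div _ _
  · filter_upwards [eventually_ge_atTop (Real.exp 1),
      (tendsto_peakRate_div_log (N := N) hα hpw k).eventually (ge_mem_nhds one_lt_two)] with P hP hP2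
    have hP0 : 0 < P := (Real.exp_pos 1).trans_le hP
    have hlog : 1 ≤ Real.log P := (Real.le_log_iff_exp_le hP0).2 hP
    have hp : ∀ n, 0 < pw P (Sum.inl n) := fun n => by rw [hpw]; exact mul_pos (hα n) hP0
    refine Eventually.of_forall fun W => ?_
    rw [Real.norm_of_nonneg (div_nonneg (excess_nonneg hp _ k) (by linarith))]
    refine (div_le_div_of_nonneg_right (excess_le hp W k) (by linarith)).trans ?_
    rw [mul_div_assoc, add_div]
    refine mul_le_mul_of_nonneg_left (add_le_add hP2 ?_) (by positivity)
    exact div_le_self (Real.log_nonneg (le_add_of_nonneg_right (sq_nonneg _))) hlog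
  · filter_upwards [ae_all_iff.2 fun x => Measure.ae_eval_ne (fun _ : U × (M ⊕ Q) => ν) x 0]
      with W hW
    exact tendsto_excess_div_log hα hpw hW k

end HighSNR

end

end HetNet

/-! ### Comparison of the optimal values under scaling of the rates. -/

/-- Two quantities between scalings, by factors that tend to `1`, of an affine family are
asymptotically equivalent. -/
theorem tendsto_sub_div_of_scaling {f g η C S I : ℝ → ℝ} {w K : ℝ} (hf : Tendsto f (𝓝 1) (𝓝 1))
    (hg : Tendsto g (𝓝 1) (𝓝 0)) (hη : Tendsto η atTop (𝓝 0))
    (hC : ∀ᶠ P in atTop, C P ≠ 0 ∧ ∀ c > 0, |g c / C P| ≤ K * |g c|)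
    (hlo : ∀ᶠ P in atTop, f (1 - η P) * C P + g (1 - η P) * w ≤ I P)
    (hIS : ∀ᶠ P in atTop, I P ≤ S P)
    (hhi : ∀ᶠ P in atTop, S P ≤ f (1 + η P) * C P + g (1 + η P) * w) :
    (∀ᶠ P in atTop, S P ≠ 0) ∧ Tendsto (fun P => (S P - I P) / S P) atTop (𝓝 0) := by
  have hlim : ∀ θ : ℝ → ℝ, Tendsto θ atTop (𝓝 1) →
      Tendsto (fun P => (f (θ P) * C P + g (θ P) * w) / C P) atTop (𝓝 1) := by
    intro θ hθ
    have h1 : Tendsto (fun P => g (θ P) / C P) atTop (𝓝 0) := by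
      have h2 : Tendsto (fun P => K * |g (θ P)|) atTop (𝓝 0) := by
        have := ((hg.comp hθ).abs).const_mul K
        simpa using this
      refine squeeze_zero_norm' ?_ h2
      filter_upwards [hC, hθ.eventually (lt_mem_nhds one_pos)] with P hP hθP
      exact hP.2 _ hθP
    have h3 := (hf.comp hθ).add (h1.mul_const w)
    rw [zero_mul, add_zero] at h3
    refine h3.congr' ?_
    filter_upwards [hC] with P hP
    rw [add_div, mul_div_assoc, div_self hP.1, mul_one, mul_div_right_comm]
    rfl
  have h1 := hlim (fun P => 1 - η P) (by simpa using hη.const_sub 1)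
  have h2 := hlim (fun P => 1 + η P) (by simpa using hη.const_add 1)
  have key : ∀ T : ℝ → ℝ, (∀ᶠ P in atTop, f (1 - η P) * C P + g (1 - η P) * w ≤ T P) →
      (∀ᶠ P in atTop, T P ≤ f (1 + η P) * C P + g (1 + η P) * w) →
      Tendsto (fun P => T P / C P) atTop (𝓝 1) := by
    intro T hl hu
    -- The sign of `C P` is not known and may reverse the bounds on division, hence minimum and
    -- maximum.
    refine tendsto_of_tendsto_of_tendsto_of_le_of_le' (by simpa using h1.min h2)
      (by simpa using h1.max h2) ?_ ?_
    · filter_upwards [hl, hu] with P hlP huP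
      rcases le_total 0 (C P) with h | h
      · exact min_le_of_left_le (div_le_div_of_nonneg_right hlP h)
      · exact min_le_of_right_le (div_le_div_of_nonpos_of_le h huP)
    · filter_upwards [hl, hu] with P hlP huP
      rcases le_total 0 (C P) with h | h
      · exact le_max_of_le_right (div_le_div_of_nonneg_right huP h)
      · exact le_max_of_le_left (div_le_div_of_nonpos_of_le h hlP)
  have hS := key S (by filter_upwards [hlo, hIS] with P h h' using h.trans h') hhi
  have hI := key I hlo (by filter_upwards [hhi, hIS] with P h h' using h'.trans h)
  have hS0 : ∀ᶠ P in atTop, S P ≠ 0 := by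
    filter_upwards [hS.eventually (lt_mem_nhds one_pos)] with P hP h0
    rw [h0, zero_div] at hP
    exact lt_irrefl _ hP
  refine ⟨hS0, ?_⟩
  have h3 := (hS.sub hI).div hS one_ne_zero
  rw [sub_self, zero_div] at h3
  refine h3.congr' ?_
  filter_upwards [hC, hS0] with P hP hSP
  rw [Pi.div_apply, ← sub_div, div_div_div_cancel_right₀ hP.1]

namespace HetNet

noncomputable section

open scoped Classical

set_option linter.unusedSectionVars false

variable {M Q U : Type*} [Fintype M] [Fintype Q] [Fintype U] {N : HetNet M Q U}
  {p : M ⊕ Q → ℝ} {ν : Measure ℂ} [IsProbabilityMeasure ν]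
  {w : U → ℝ} {D : Set ℝ} {u : ℝ → ℝ} {Θ : Finset (Finset N.BUser)} {q : Finset N.BUser → ℝ}

theorem mixRate_le_peakRate (hp : ∀ n, 0 < p (Sum.inl n)) (h0 : ∀ V, 0 ≤ q V)
    (h1 : ∑ V ∈ Θ, q V = 1) (k : N.BUser) : N.mixRate p Θ q k ≤ N.peakRate p k := by
  rw [← one_mul (N.peakRate p k), ← h1, Finset.sum_mul]
  refine Finset.sum_le_sum fun V _ => mul_le_mul_of_nonneg_left ?_ (h0 V)
  by_cases h : k ∈ V
  · rw [detRate_of_mem h]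
  · simp [detRate, h, (peakRate_pos hp k).le]

theorem utilitySet_mono {𝒜 ℬ : Finset (Pattern M)} (h : 𝒜 ⊆ ℬ) :
    N.utilitySet ν w D u p 𝒜 ⊆ N.utilitySet ν w D u p ℬ := by
  rintro x ⟨r, π, hr, hD, rfl⟩
  exact ⟨r, π, ⟨hr.1, hr.2.1, fun a ha => hr.2.2 a fun h' => ha (h h')⟩, hD, rfl⟩

/-- Time sharing between maximal independent sets gives a lower bound for the optimal utility of
the profile of their patterns. -/
theorem MixFeasible.exists_mem_utilitySet [Nonempty N.BUser] [NullSingletonClass ν]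
    (hν : Integrable (fun z : ℂ => Real.log (1 + ‖z‖ ^ 2)) ν) (hu : IsUtility D u)
    (hw : ∀ k, 0 ≤ w k) (hp : ∀ n, 0 < p (Sum.inl n)) {f g : ℝ → ℝ}
    (hfg : ∀ c > 0, 0 < f c ∧ ∀ r ∈ D, u (c * r) = f c * u r + g c)
    (hΘ : ∀ V ∈ Θ, N.IsMIS V) (h : N.MixFeasible w D p Θ q) :
    ∃ x ∈ N.utilitySet ν w D u p (N.outputProfile Θ q), ∀ c > 0,
      (∀ k, c * N.peakRate p k ≤ N.meanRate ν p k) →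
        f c * N.mixUtility w u p Θ q + g c * ∑ k : N.BUser, w k ≤ x := by
  obtain ⟨π, hπ⟩ := exists_policy ν h.1 fun V hV => hΘ V (by
    by_contra h'; exact hV (h.2.1 V h'))
  set x : N.BUser → ℝ := fun k => ∑ V, if k ∈ V then q V else 0 with hx
  have hx0 : ∀ k, 0 ≤ x k := fun k => Finset.sum_nonneg fun V _ => by
    split_ifs; exacts [h.1 V, le_rfl]
  have hmix : ∀ k, N.mixRate p Θ q k = x k * N.peakRate p k := mixRate_eq_mul_peakRate h.2.1
  have hD : ∀ k : N.BUser, w k ≠ 0 → N.avgInfo ν p (N.patternLaw q) π k ∈ D := by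
    intro k hk
    have h1 := h.2.2.2 k hk
    have h2 := peakRate_pos hp k
    have h3 := hu.mul_mem (div_pos (meanRate_pos hν hp k) h2) h1
    rw [hmix] at h3
    rw [hπ]
    convert h3 using 1
    rw [div_mul_eq_mul_div, mul_left_comm, mul_div_assoc, mul_div_cancel_right₀ _ h2.ne']
  refine ⟨_, ⟨_, π, isControl_patternLaw h.1 h.2.1 h.2.2.1, hD, rfl⟩, fun c hc hle => ?_⟩
  rw [mixUtility, Finset.mul_sum, Finset.mul_sum, ← Finset.sum_add_distrib]
  refine Finset.sum_le_sum fun k _ => ?_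
  by_cases hk : w k = 0
  · simp [hk]
  have h1 := (hfg c hc).2 _ (h.2.2.2 k hk)
  have h2 : u (c * N.mixRate p Θ q k) ≤ u (N.avgInfo ν p (N.patternLaw q) π k) := by
    refine hu.mono (hu.mul_mem hc (h.2.2.2 k hk)) ?_
    rw [hπ, hmix, mul_left_comm]
    exact mul_le_mul_of_nonneg_left (hle k) (hx0 k)
  have := mul_le_mul_of_nonneg_left h2 (hw k)
  rw [h1] at this
  linarith

/-- An upper bound for the utilities, in terms of a point `q₀` whose rates dominate the gap. -/
theorem le_of_mem_utilitySet (hν : Integrable (fun z : ℂ => Real.log (1 + ‖z‖ ^ 2)) ν)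
    (hu : IsUtility D u) (hw : ∀ k, 0 ≤ w k) (hp : ∀ n, 0 < p (Sum.inl n)) {f g : ℝ → ℝ}
    (hfg : ∀ c > 0, 0 < f c ∧ ∀ r ∈ D, u (c * r) = f c * u r + g c)
    {q₀ : Finset N.BUser → ℝ} (hq₀ : N.MixFeasible w D p N.allMIS q₀)
    (h : N.MixOptimal w D u p N.allMIS q) {η : ℝ}
    (hη : 0 ≤ η) (hgap : ∀ k, N.gap ν p k ≤ η * N.mixRate p N.allMIS q₀ k)
    {𝒜 : Finset (Pattern M)} {x : ℝ} (hx : x ∈ N.utilitySet ν w D u p 𝒜) :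
    x ≤ f (1 + η) * N.mixUtility w u p N.allMIS q + g (1 + η) * ∑ k : N.BUser, w k := by
  obtain ⟨r, π, hr, hD, rfl⟩ := hx
  obtain ⟨q₁, h0, h1, h2, hle⟩ := exists_avgInfo_le hν hp hr π
  have hη1 : 0 < 1 + η := by linarith
  -- Homogeneity handles scalings, not additive errors. The gap is therefore bounded by `η` times
  -- the rates of `q₀`, and `q₁ + η q₀` is normalized by `1 + η`.
  set q' : Finset N.BUser → ℝ := fun V => (1 + η)⁻¹ * q₁ V + ((1 + η)⁻¹ * η) * q₀ V with hq'
  have hrate : ∀ k, (1 + η) * N.mixRate p N.allMIS q' k =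
      N.mixRate p N.allMIS q₁ k + η * N.mixRate p N.allMIS q₀ k := by
    intro k
    rw [hq', mixRate_smul_add]
    field_simp
  have hbound : ∀ k : N.BUser, N.avgInfo ν p r π k ≤ (1 + η) * N.mixRate p N.allMIS q' k :=
    fun k => by rw [hrate]; exact (hle k).trans (add_le_add_right (hgap k) _)
  have hD' : ∀ k : N.BUser, w k ≠ 0 → N.mixRate p N.allMIS q' k ∈ D := by
    intro k hk
    have := hu.mul_mem (inv_pos.2 hη1) (hu.mem_of_le (hD k hk) (hbound k))
    rwa [inv_mul_cancel_left₀ hη1.ne'] at this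
  have hfe : N.MixFeasible w D p N.allMIS q' := by
    refine ⟨fun V => ?_, fun V hV => by simp [hq', h1 V hV, hq₀.2.1 V hV], ?_, hD'⟩
    · have := inv_pos.2 hη1
      exact add_nonneg (mul_nonneg this.le (h0 V))
        (mul_nonneg (mul_nonneg this.le hη) (hq₀.1 V))
    · rw [hq', Finset.sum_add_distrib, ← Finset.mul_sum, ← Finset.mul_sum, h2, hq₀.2.2.1]
      field_simp
  refine le_trans ?_ (add_le_add_left (mul_le_mul_of_nonneg_left (h.2 q' hfe)
    (hfg _ hη1).1.le) _)
  rw [mixUtility, Finset.mul_sum, Finset.mul_sum, ← Finset.sum_add_distrib]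
  refine Finset.sum_le_sum fun k _ => ?_
  by_cases hk : w k = 0
  · simp [hk]
  have h3 := mul_le_mul_of_nonneg_left (hu.mono (hD k hk) (hbound k)) (hw k)
  rw [(hfg _ hη1).2 _ (hD' k hk)] at h3
  linarith

theorem exists_mixOptimal_allMIS [Nonempty N.BUser] (hu : IsUtility D u) (hw : ∀ k, 0 ≤ w k)
    (hp : ∀ n, 0 < p (Sum.inl n)) : ∃ q, N.MixOptimal w D u p N.allMIS q := by
  obtain ⟨q₀, hq₀⟩ := (isInitial_allMIS (N := N)).exists_feasible hu w
  exact (hq₀ p hp).1.exists_optimal hu hw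

theorem bddAbove_utilitySet [Nonempty N.BUser]
    (hν : Integrable (fun z : ℂ => Real.log (1 + ‖z‖ ^ 2)) ν)
    (hu : IsUtility D u) (hw : ∀ k, 0 ≤ w k) (hp : ∀ n, 0 < p (Sum.inl n))
    (𝒜 : Finset (Pattern M)) : BddAbove (N.utilitySet ν w D u p 𝒜) := by
  obtain ⟨f, g, hfg⟩ := hu.homogeneous
  obtain ⟨q₀, hq₀⟩ := (isInitial_allMIS (N := N)).exists_feasible hu w
  obtain ⟨q, hq⟩ := exists_mixOptimal_allMIS (N := N) hu hw hp
  have hterm : ∀ k, 0 ≤ N.gap ν p k / N.mixRate p N.allMIS q₀ k := fun k =>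
    div_nonneg (gap_nonneg hp k) ((hq₀ p hp).2 k).le
  refine ⟨_, fun x hx => le_of_mem_utilitySet hν hu hw hp hfg (hq₀ p hp).1 hq
    (η := ∑ k, N.gap ν p k / N.mixRate p N.allMIS q₀ k) (Finset.sum_nonneg fun k _ => hterm k)
    (fun k => ?_) hx⟩
  rw [← div_le_iff₀ ((hq₀ p hp).2 k)]
  exact Finset.single_le_sum (fun k _ => hterm k) (Finset.mem_univ k)

theorem isLUB_profileValue [Nonempty N.BUser]
    (hν : Integrable (fun z : ℂ => Real.log (1 + ‖z‖ ^ 2)) ν)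
    (hu : IsUtility D u) (hw : ∀ k, 0 ≤ w k) (hp : ∀ n, 0 < p (Sum.inl n))
    {𝒜 : Finset (Pattern M)} (hne : (N.utilitySet ν w D u p 𝒜).Nonempty) :
    IsLUB (N.utilitySet ν w D u p 𝒜) (N.profileValue ν w D u p 𝒜) :=
  isLUB_csSup hne (bddAbove_utilitySet hν hu hw hp 𝒜)

theorem nonempty_utilitySet_outputProfile [Nonempty N.BUser] [NullSingletonClass ν]
    (hν : Integrable (fun z : ℂ => Real.log (1 + ‖z‖ ^ 2)) ν) (hu : IsUtility D u)
    (hw : ∀ k, 0 ≤ w k) (hp : ∀ n, 0 < p (Sum.inl n))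
    (hΘ : ∀ V ∈ Θ, N.IsMIS V) (h : N.MixFeasible w D p Θ q) :
    (N.utilitySet ν w D u p (N.outputProfile Θ q)).Nonempty := by
  obtain ⟨f, g, hfg⟩ := hu.homogeneous
  obtain ⟨x, hx, -⟩ := h.exists_mem_utilitySet hν hu hw hp hfg hΘ
  exact ⟨x, hx⟩

theorem subset_allPatterns (𝒜 : Finset (Pattern M)) : 𝒜 ⊆ allPatterns M := by
  intro a _
  simp [allPatterns]

theorem isLUB_optValue [Nonempty N.BUser] [NullSingletonClass ν]
    (hν : Integrable (fun z : ℂ => Real.log (1 + ‖z‖ ^ 2)) ν) (hu : IsUtility D u)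
    (hw : ∀ k, 0 ≤ w k) (hp : ∀ n, 0 < p (Sum.inl n)) :
    IsLUB (N.utilitySet ν w D u p (allPatterns M)) (N.optValue ν w D u p) := by
  obtain ⟨q, hq⟩ := exists_mixOptimal_allMIS (N := N) hu hw hp
  exact isLUB_profileValue hν hu hw hp ((nonempty_utilitySet_outputProfile hν hu hw hp
    (fun _ => mem_allMIS.1) hq.1).mono (utilitySet_mono (subset_allPatterns _)))

theorem profileValue_of_weight_eq_zero (hw : ∀ k : N.BUser, w k = 0) (𝒜 : Finset (Pattern M)) :
    N.profileValue ν w D u p 𝒜 = 0 := by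
  have hsub : N.utilitySet ν w D u p 𝒜 ⊆ {0} := by
    rintro x ⟨r, π, -, -, rfl⟩
    simp [hw]
  rcases Set.subset_singleton_iff_eq.1 hsub with h | h <;> simp [profileValue, h]

section HighSNR

variable {α : M → ℝ} {pw : ℝ → M ⊕ Q → ℝ}

/-- The optimal value over all maximal independent sets does not vanish, and stays away from zero
unless the utility is a power. -/
theorem eventually_mixValue_ne_zero [Nonempty N.BUser] (hu : IsUtility D u)
    (hw : ∀ k, 0 ≤ w k) (hwpos : ∃ k : N.BUser, 0 < w k) (hα : ∀ n, 0 < α n)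
    (hpw : ∀ P n, pw P (Sum.inl n) = α n * P) {f g : ℝ → ℝ}
    (hfg : ∀ c > 0, 0 < f c ∧ ∀ r ∈ D, u (c * r) = f c * u r + g c) :
    ∃ K : ℝ, ∀ᶠ P in atTop, N.mixValue w D u (pw P) N.allMIS ≠ 0 ∧
      ∀ c > 0, |g c / N.mixValue w D u (pw P) N.allMIS| ≤ K * |g c| := by
  set C : ℝ → ℝ := fun P => N.mixValue w D u (pw P) N.allMIS with hC
  -- The term with `g` is harmless when `C` stays away from zero; otherwise `g` itself has to
  -- vanish.
  have haway : ∀ c₀ > 0, (∀ᶠ P in atTop, c₀ ≤ |C P|) →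
      ∃ K : ℝ, ∀ᶠ P in atTop, C P ≠ 0 ∧ ∀ c > 0, |g c / C P| ≤ K * |g c| := by
    intro c₀ h0 h
    refine ⟨c₀⁻¹, ?_⟩
    filter_upwards [h] with P hP
    have hP0 : 0 < |C P| := h0.trans_le hP
    refine ⟨abs_pos.1 hP0, fun c _ => ?_⟩
    rw [abs_div, div_eq_inv_mul]
    exact mul_le_mul_of_nonneg_right (inv_anti₀ h0 hP) (abs_nonneg _)
  obtain ⟨q₀, hq₀⟩ := (isInitial_allMIS (N := N)).exists_feasible hu w
  have hp : ∀ P > 0, ∀ n, 0 < pw P (Sum.inl n) := fun P hP n => by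
    rw [hpw]; exact mul_pos (hα n) hP
  set W := ∑ k : N.BUser, w k with hW
  have hWpos : 0 < W := by
    obtain ⟨k, hk⟩ := hwpos
    exact Finset.sum_pos' (fun k _ => hw k) ⟨k, Finset.mem_univ k, hk⟩
  have hrate : ∀ k, Tendsto (fun P => N.mixRate (pw P) N.allMIS q₀ k) atTop atTop := by
    intro k
    have h1 := (hq₀ _ (hp 1 one_pos))
    have h2 : ∀ P, N.mixRate (pw P) N.allMIS q₀ k =
        (∑ V, if k ∈ V then q₀ V else 0) * N.peakRate (pw P) k := fun P =>
      mixRate_eq_mul_peakRate h1.1.2.1 k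
    have h3 := h1.2 k
    rw [h2] at h3
    simp only [h2]
    exact (tendsto_peakRate_atTop hα hpw k).const_mul_atTop
      (pos_of_mul_pos_left h3 (peakRate_pos (hp 1 one_pos) k).le)
  have hlow : ∀ R : ℝ, (∀ᶠ r in atTop, R ≤ u r) → ∀ᶠ P in atTop, W * R ≤ C P := by
    intro R hR
    have h1 : ∀ᶠ P in atTop, ∀ k, R ≤ u (N.mixRate (pw P) N.allMIS q₀ k) :=
      eventually_all.2 fun k => (hrate k).eventually hR
    filter_upwards [h1, eventually_gt_atTop 0] with P hP hP0
    obtain ⟨q, hq⟩ := exists_mixOptimal_allMIS (N := N) hu hw (hp P hP0)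
    rw [hC]
    simp only
    rw [hq.mixValue_eq, hW, Finset.sum_mul]
    exact (Finset.sum_le_sum fun k _ => mul_le_mul_of_nonneg_left (hP k) (hw k)).trans
      (hq.2 q₀ (hq₀ _ (hp P hP0)).1)
  have htop : Tendsto u atTop atTop → ∃ K : ℝ, ∀ᶠ P in atTop, C P ≠ 0 ∧
      ∀ c > 0, |g c / C P| ≤ K * |g c| := by
    intro h
    refine haway 1 one_pos ?_
    filter_upwards [hlow W⁻¹ (h.eventually_ge_atTop _)] with P hP
    rw [mul_inv_cancel₀ hWpos.ne'] at hP
    exact hP.trans (le_abs_self _)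
  rcases hu.trichotomy with ⟨hd, A, B, hA, h⟩ | ⟨hd, A, B, r, hA, hr, -, h⟩ |
    ⟨hd, A, B, r, hA, hr, h⟩
  · refine htop ?_
    have h1 : Tendsto (fun x => A * Real.log x + B) atTop atTop :=
      tendsto_atTop_add_const_right _ _ (Real.tendsto_log_atTop.const_mul_atTop hA)
    refine h1.congr' ?_
    filter_upwards [eventually_gt_atTop 0] with x hx using (h x hx).symm
  · refine htop ?_
    have h1 : Tendsto (fun x : ℝ => A * x ^ r + B) atTop atTop :=
      tendsto_atTop_add_const_right _ _ ((tendsto_rpow_atTop hr).const_mul_atTop hA)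
    refine h1.congr' ?_
    filter_upwards [eventually_ge_atTop 0] with x hx using (h x hx).symm
  · have hlim : Tendsto u atTop (𝓝 B) := by
      have h1 : Tendsto (fun x : ℝ => A * x ^ r + B) atTop (𝓝 B) := by
        have := ((tendsto_rpow_neg_atTop (neg_pos.2 hr)).const_mul A).add_const B
        simpa using this
      refine h1.congr' ?_
      filter_upwards [eventually_gt_atTop 0] with x hx using (h x hx).symm
    have hup : ∀ P > 0, C P < W * B := by
      intro P hP
      obtain ⟨q, hq⟩ := exists_mixOptimal_allMIS (N := N) hu hw (hp P hP)
      rw [hC]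
      simp only
      rw [hq.mixValue_eq, hW, Finset.sum_mul, mixUtility]
      have hlt : ∀ k : N.BUser, w k ≠ 0 → u (N.mixRate (pw P) N.allMIS q k) < B := by
        intro k hk
        have hx : 0 < N.mixRate (pw P) N.allMIS q k := by
          have := hq.1.2.2.2 k hk
          rwa [hd] at this
        rw [h _ hx]
        have := mul_neg_of_neg_of_pos hA (Real.rpow_pos_of_pos hx r)
        linarith
      obtain ⟨k, hk⟩ := hwpos
      refine Finset.sum_lt_sum (fun j _ => ?_) ⟨k, Finset.mem_univ k, ?_⟩
      · by_cases hj : w j = 0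
        · simp [hj]
        · exact mul_le_mul_of_nonneg_left (hlt j hj).le (hw j)
      · exact mul_lt_mul_of_pos_left (hlt k hk.ne') hk
    -- For a negative exponent the values approach `W * B` from below. If `B = 0` they may tend to
    -- zero, but then letting `x → ∞` in the homogeneity relation gives `g = 0`.
    by_cases hB : B = 0
    · refine ⟨0, ?_⟩
      filter_upwards [eventually_gt_atTop 0] with P hP
      have hCneg : C P < 0 := by simpa [hB] using hup P hP
      refine ⟨hCneg.ne, fun c hc => ?_⟩
      have hg : g c = 0 := by
        have h1 : Tendsto (fun x => u (c * x) - f c * u x) atTop (𝓝 0) := by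
          have := (hlim.comp (tendsto_id.const_mul_atTop hc)).sub (hlim.const_mul (f c))
          simpa [hB] using this
        refine tendsto_nhds_unique (tendsto_const_nhds (x := g c) (f := atTop (α := ℝ))) ?_
        refine h1.congr' ?_
        filter_upwards [eventually_gt_atTop 0] with x hx
        rw [(hfg c hc).2 x (hu.pos_mem hx)]
        ring
      simp [hg]
    · have hB0 : 0 < |B| := abs_pos.2 hB
      refine haway (W * (|B| / 2)) (by positivity) ?_
      have h1 : ∀ᶠ P in atTop, W * (B - |B| / 2) ≤ C P :=
        hlow _ (hlim.eventually (le_mem_nhds (by linarith)))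
      filter_upwards [h1, eventually_gt_atTop 0] with P hP hP0
      have h2 := hup P hP0
      rcases le_or_gt 0 B with h3 | h3
      · rw [abs_of_nonneg h3] at hP ⊢
        refine le_trans ?_ (le_abs_self _)
        linarith
      · rw [abs_of_neg h3] at hP ⊢
        refine le_trans ?_ (neg_le_abs _)
        nlinarith

/-- If the time sharing coefficients are optimal over all maximal independent sets, then the
profile of their patterns is asymptotically optimal. -/
theorem tendsto_relative_loss [Nonempty N.BUser] [NullSingletonClass ν]
    (hν : Integrable (fun z : ℂ => Real.log (1 + ‖z‖ ^ 2)) ν) (hu : IsUtility D u)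
    (hw : ∀ k, 0 ≤ w k) (hwpos : ∃ k : N.BUser, 0 < w k) (hα : ∀ n, 0 < α n)
    (hpw : ∀ P n, pw P (Sum.inl n) = α n * P) {𝒜 : ℝ → Finset (Pattern M)}
    (h𝒜 : ∀ P > 0, ∃ Θ q, (∀ V ∈ Θ, N.IsMIS V) ∧ N.MixFeasible w D (pw P) Θ q ∧
      N.MixOptimal w D u (pw P) N.allMIS q ∧ 𝒜 P = N.outputProfile Θ q) :
    (∀ᶠ P in atTop, N.optValue ν w D u (pw P) ≠ 0) ∧
    Tendsto (fun P => (N.optValue ν w D u (pw P) - N.profileValue ν w D u (pw P) (𝒜 P)) /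
      N.optValue ν w D u (pw P)) atTop (𝓝 0) := by
  obtain ⟨f, g, hfg, hf, hg⟩ := hu.exists_scaling
  obtain ⟨K, hK⟩ := eventually_mixValue_ne_zero hu hw hwpos hα hpw hfg
  obtain ⟨q₀, hq₀⟩ := (isInitial_allMIS (N := N)).exists_feasible hu w
  have hp : ∀ P > 0, ∀ n, 0 < pw P (Sum.inl n) := fun P hP n => by
    rw [hpw]; exact mul_pos (hα n) hP
  -- The coefficients `q₀` do not depend on `P`, so their rates grow like `log P` and dominate the
  -- gap. The sum serves as a bound for all users simultaneously.
  set η : ℝ → ℝ := fun P => ∑ k, N.gap ν (pw P) k / N.mixRate (pw P) N.allMIS q₀ k with hη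
  have hterm : ∀ P > 0, ∀ k, 0 ≤ N.gap ν (pw P) k / N.mixRate (pw P) N.allMIS q₀ k :=
    fun P hP k => div_nonneg (gap_nonneg (hp P hP) k) ((hq₀ _ (hp P hP)).2 k).le
  have hη0 : ∀ P > 0, 0 ≤ η P := fun P hP => Finset.sum_nonneg fun k _ => hterm P hP k
  have hgap : ∀ P > 0, ∀ k, N.gap ν (pw P) k ≤ η P * N.mixRate (pw P) N.allMIS q₀ k := by
    intro P hP k
    rw [← div_le_iff₀ ((hq₀ _ (hp P hP)).2 k)]
    exact Finset.single_le_sum (fun k _ => hterm P hP k) (Finset.mem_univ k)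
  have hηlim : Tendsto η atTop (𝓝 0) := by
    rw [← Finset.sum_const_zero (s := (Finset.univ : Finset N.BUser))]
    refine tendsto_finsetSum _ fun k _ => ?_
    have h1 := hq₀ _ (hp 1 one_pos)
    have h2 : ∀ P, N.mixRate (pw P) N.allMIS q₀ k =
        (∑ V, if k ∈ V then q₀ V else 0) * N.peakRate (pw P) k := fun P =>
      mixRate_eq_mul_peakRate h1.1.2.1 k
    have h3 := h1.2 k
    rw [h2] at h3
    have h4 : (∑ V, if k ∈ V then q₀ V else 0) ≠ 0 := left_ne_zero_of_mul h3.ne'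
    have h5 := (tendsto_gap_div_log hν hα hpw k).div
      ((tendsto_peakRate_div_log hα hpw k).const_mul (∑ V, if k ∈ V then q₀ V else 0))
      (by simpa using h4)
    rw [zero_div] at h5
    refine h5.congr' ?_
    filter_upwards [eventually_gt_atTop 1] with P hP
    rw [Pi.div_apply, h2, ← mul_div_assoc, div_div_div_cancel_right₀ (Real.log_pos hP).ne']
  refine tendsto_sub_div_of_scaling (w := ∑ k : N.BUser, w k) hf hg hηlim hK ?_ ?_ ?_
  · filter_upwards [eventually_gt_atTop 0, hηlim.eventually (gt_mem_nhds one_pos)] with P hP hP1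
    obtain ⟨Θ, q, hΘ, hfe, hopt, heq⟩ := h𝒜 P hP
    obtain ⟨x, hx, hxle⟩ := hfe.exists_mem_utilitySet hν hu hw (hp P hP) hfg hΘ
    rw [heq, hopt.mixValue_eq, mixUtility_eq hopt.1.2.1 hfe.2.1]
    refine (hxle _ (sub_pos.2 hP1) fun k => ?_).trans
      (le_csSup (bddAbove_utilitySet hν hu hw (hp P hP) _) hx)
    refine le_trans ?_ (peakRate_sub_gap_le hν (hp P hP) k)
    have h1 := hgap P hP k
    have h2 := mul_le_mul_of_nonneg_left (mixRate_le_peakRate (hp P hP) (hq₀ _ (hp P hP)).1.1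
      (hq₀ _ (hp P hP)).1.2.2.1 k) (hη0 P hP)
    linarith
  · filter_upwards [eventually_gt_atTop 0] with P hP
    obtain ⟨Θ, q, hΘ, hfe, -, heq⟩ := h𝒜 P hP
    refine csSup_le_csSup (bddAbove_utilitySet hν hu hw (hp P hP) _) ?_
      (utilitySet_mono (subset_allPatterns _))
    rw [heq]
    exact nonempty_utilitySet_outputProfile hν hu hw (hp P hP) hΘ hfe
  · filter_upwards [eventually_gt_atTop 0] with P hP
    obtain ⟨Θ, q, -, -, hopt, -⟩ := h𝒜 P hP
    rw [hopt.mixValue_eq]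
    exact (isLUB_optValue hν hu hw (hp P hP)).2 fun x hx =>
      le_of_mem_utilitySet hν hu hw (hp P hP) hfg (hq₀ _ (hp P hP)).1 hopt (hη0 P hP)
        (hgap P hP) hx

end HighSNR

end

end HetNet

theorem theorem4 {M Q U : Type*} [Fintype M] [Fintype Q] [Fintype U]
    (N : HetNet M Q U) (hB : Nonempty N.BUser)
    -- law of the small scale fading coefficients
    (ν : MeasureTheory.Measure ℂ) [MeasureTheory.IsProbabilityMeasure ν]
    [MeasureTheory.NullSingletonClass ν]
    (hν : MeasureTheory.Integrable (fun z : ℂ => Real.log (1 + ‖z‖ ^ 2)) ν)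
    -- weights and utility
    (w : U → ℝ) (hw : ∀ k, 0 ≤ w k)
    (D : Set ℝ) (u : ℝ → ℝ) (hu : IsUtility D u)
    -- transmit powers: those of the macro base stations are proportional to `P`
    (α : M → ℝ) (hα : ∀ n, 0 < α n) (pw : ℝ → M ⊕ Q → ℝ)
    (hpw : ∀ P n, pw P (Sum.inl n) = α n * P) :
    -- the algorithm can be started, and both steps can be carried out in every state it reaches
    (∃ Θ, N.IsInitial Θ) ∧
    (∀ P > 0, ∀ Θ, N.Reachable w D u (pw P) Θ →
      (∃ q, N.MixReduced w D u (pw P) Θ q) ∧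
      ∀ q, N.MixOptimal w D u (pw P) Θ q → ∃ V, N.IsNewColumn w D u (pw P) Θ q V) ∧
    -- every run terminates, with at most `|U_B|` patterns
    (∀ P > 0, ∀ Θ q V, N.IsRun w D u (pw P) Θ q V → ∀ ε ≥ 0,
      ∃ i, N.StopsAt w D u (pw P) ε Θ i ∧
        (N.MixReduced w D u (pw P) (Θ i) (q i) →
          (N.outputProfile (Θ i) (q i)).card ≤ Nat.card N.BUser)) ∧
    -- the optimal values are finite suprema
    (∀ P > 0, IsLUB (N.utilitySet ν w D u (pw P) (HetNet.allPatterns M)) (N.optValue ν w D u (pw P)) ∧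
      ∀ ε ≥ 0, ∀ 𝒜, N.IsOutput w D u (pw P) ε 𝒜 →
        IsLUB (N.utilitySet ν w D u (pw P) 𝒜) (N.profileValue ν w D u (pw P) 𝒜)) ∧
    ((∃ k : N.BUser, 0 < w k) → ∀ᶠ P in Filter.atTop, N.optValue ν w D u (pw P) ≠ 0) ∧
    -- asymptotic optimality
    (∃ ε₀ : ℝ → ℝ, (∀ P > 0, 0 < ε₀ P) ∧
      ∀ (ε : ℝ → ℝ) (𝒜 : ℝ → Finset (Pattern M)),
        (∀ P > 0, 0 ≤ ε P ∧ ε P < ε₀ P ∧ N.IsOutput w D u (pw P) (ε P) (𝒜 P)) →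
        Filter.Tendsto
          (fun P => (N.optValue ν w D u (pw P) - N.profileValue ν w D u (pw P) (𝒜 P)) /
            N.optValue ν w D u (pw P))
          Filter.atTop (nhds 0)) := by
  have hp : ∀ P > 0, ∀ n, 0 < pw P (Sum.inl n) := fun P hP n => by
    rw [hpw]; exact mul_pos (hα n) hP
  refine ⟨⟨N.allMIS, HetNet.isInitial_allMIS⟩, fun P hP Θ hΘ => ⟨?_, fun q _ =>
    HetNet.exists_isNewColumn w D u (pw P) Θ q⟩, fun P hP Θ q V hrun ε hε => ?_, fun P hP =>
    ⟨HetNet.isLUB_optValue hν hu hw (hp P hP), ?_⟩, fun hwpos => ?_, ?_⟩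
  · obtain ⟨q, hq⟩ := hΘ.exists_feasible hu (hp P hP)
    obtain ⟨q, hq⟩ := hq.exists_optimal hu hw
    exact hq.exists_reduced
  · obtain ⟨i, hi⟩ := hrun.exists_stopsAt hε
    exact ⟨i, hi, fun h => h.card_outputProfile_le hu hw (hp P hP) (hrun.isMIS i)⟩
  · rintro ε - 𝒜 ⟨Θ, q, V, i, hrun, -, rfl⟩
    exact HetNet.isLUB_profileValue hν hu hw (hp P hP)
      (HetNet.nonempty_utilitySet_outputProfile hν hu hw (hp P hP) (hrun.isMIS i) (hrun.step1 i).1)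
  · have hq : ∀ P, ∃ q, 0 < P → N.MixOptimal w D u (pw P) N.allMIS q := fun P => by
      by_cases hP : 0 < P
      · exact (HetNet.exists_mixOptimal_allMIS hu hw (hp P hP)).imp fun q hq _ => hq
      · exact ⟨0, fun h => absurd h hP⟩
    choose q hq using hq
    -- The nonvanishing of the optimal value does not involve the profile, so the one from `allMIS`
    -- can be inserted, without any run.
    exact (HetNet.tendsto_relative_loss (𝒜 := fun P => N.outputProfile N.allMIS (q P)) hν hu hw
      hwpos hα hpw fun P hP => ⟨N.allMIS, q P, fun _ => HetNet.mem_allMIS.1, (hq P hP).1, hq P hP,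
        rfl⟩).1
  · have htol : ∀ P, ∃ ε₀ > 0, 0 < P → ∀ ε < ε₀, ∀ Θ q V i, N.IsRun w D u (pw P) Θ q V →
        N.StopsAt w D u (pw P) ε Θ i → N.MixOptimal w D u (pw P) N.allMIS (q i) := fun P => by
      by_cases hP : 0 < P
      · obtain ⟨ε₀, h0, h⟩ := HetNet.exists_tolerance (N := N) hu hw (hp P hP)
        exact ⟨ε₀, h0, fun _ => h⟩
      · exact ⟨1, one_pos, fun h => absurd h hP⟩
    choose ε₀ hε₀ htol using htol
    refine ⟨ε₀, fun P _ => hε₀ P, fun ε 𝒜 h𝒜 => ?_⟩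
    by_cases hwpos : ∃ k : N.BUser, 0 < w k
    · refine (HetNet.tendsto_relative_loss hν hu hw hwpos hα hpw fun P hP => ?_).2
      obtain ⟨-, hlt, Θ, q, V, i, hrun, hfinal, heq⟩ := h𝒜 P hP
      exact ⟨Θ i, q i, hrun.isMIS i, (hrun.step1 i).1,
        htol P hP _ hlt Θ q V i hrun hfinal, heq⟩
    -- With all weights zero the optimal value is zero, and division by zero returns the value `0`
    -- prescribed for the quotient.
    · push Not at hwpos
      have h0 : ∀ P, N.optValue ν w D u (pw P) = 0 := fun P =>
        HetNet.profileValue_of_weight_eq_zero (fun k => le_antisymm (hwpos k) (hw k)) _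
      simp [h0]
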